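/- Work over $\mathbb{C}$. A projective camera is a matrix $A\in\mathbb{C}^{3\times 4}$ of rank three, regarded as a rational map $\mathbb{P}^3\dashrightarrow\mathbb{P}^2$; its center is the unique point $a\in\mathbb{P}^3$ with $Aa=0$. For ordered $n$-tuples $\mathcal{X}=(x_1,\dots,x_n)$ and $\mathcal{Y}=(y_1,\dots,y_n)$ of points of $\mathbb{P}^3$, let $L(\mathcal{X},\mathcal{Y})\subset\mathbb{P}^3\times\mathbb{P}^3$ be the set of pairs $(a,b)$ for which there are projective cameras $A$, $B$ with centers $a$, $b$ such that $Ax_i\neq 0$ and $By_i\neq 0$ for all $i$ (that is, $a\notin\mathcal{X}$ and $b\notin\mathcal{Y}$), and such that for some $H\in\mathrm{SL}(3,\mathbb{C})$ one has $Ax_i=HBy_i$ in $\mathbb{P}^2$ for all $i$. The centers-variety of $(\mathcal{X},\mathcal{Y})$ is the Zariski closure of $L(\mathcal{X},\mathcal{Y})$ in $\mathbb{P}^3\times\mathbb{P}^3$. Theorem. Let $n\ge 0$. For generic $\mathcal{X},\mathcal{Y}$, that is, for all $(\mathcal{X},\mathcal{Y})$ in some nonempty Zariski open subset of $(\mathbb{P}^3)^n\times(\mathbb{P}^3)^n$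 depending only on $n$: (i) if $n\le 4$, the centers-variety is all of $\mathbb{P}^3\times\mathbb{P}^3$; (ii) if $n\in\{5,6,7\}$, the centers-variety has dimension at least $14-2n$ (in particular it is nonempty). The same conclusions hold if the centers-variety is replaced by the Zariski closure of the set of those $(a,b)\in L(\mathcal{X},\mathcal{Y})$ such that $a$ is on no line through two points of $\mathcal{X}$ (and $a\notin\mathcal{X}$), and $b$ is on no line through two points of $\mathcal{Y}$ (and $b\notin\mathcal{Y}$). -/

import Mathlib

open scoped LinearAlgebra.Projectivization

/-- Complex projective `3`-space. -/
abbrev P3 : Type := ℙ ℂ (Fin 4 → ℂ)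

/-- The product of copies of `ℙ³` indexed by `ι`. It carries the Zariski topology defined below (not
a product topology: `ℙ³` itself is given no topology here). -/
abbrev MultiProj (ι : Type) : Type := ι → P3

/-- `F` is a multihomogeneous polynomial: homogeneous in each of the groups of four
variables `(i, 0), …, (i, 3)`. -/
def IsMultihomogeneous {ι : Type} [DecidableEq ι] (F : MvPolynomial (ι × Fin 4) ℂ) : Prop :=
  ∃ d : ι → ℕ,
    MvPolynomial.IsWeightedHomogeneous (fun p : ι × Fin 4 => (Pi.single p.1 1 : ι → ℕ)) F d

/-- `F` vanishes at the point `x`, for every choice of homogeneous coordinates of `x`. -/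
def VanishesAt {ι : Type} (F : MvPolynomial (ι × Fin 4) ℂ) (x : MultiProj ι) : Prop :=
  ∀ v : ι → Fin 4 → ℂ, (∀ i, ∃ h : v i ≠ 0, Projectivization.mk ℂ (v i) h = x i) →
    MvPolynomial.eval (fun p => v p.1 p.2) F = 0

/-- The common zero locus of a set of polynomials in a product of projective spaces. -/
def projZeroLocus {ι : Type} (S : Set (MvPolynomial (ι × Fin 4) ℂ)) : Set (MultiProj ι) :=
  {x | ∀ F ∈ S, VanishesAt F x}

/-- Rescaling the coordinates of each factor multiplies the value of a multihomogeneous polynomial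
by a monomial in the scalars. -/
theorem eval_rescale {ι : Type} [Fintype ι] [DecidableEq ι] {F : MvPolynomial (ι × Fin 4) ℂ}
    {d : ι → ℕ}
    (hF : MvPolynomial.IsWeightedHomogeneous
      (fun p : ι × Fin 4 => (Pi.single p.1 1 : ι → ℕ)) F d)
    (c : ι → ℂ) (v : ι → Fin 4 → ℂ) :
    MvPolynomial.eval (fun p : ι × Fin 4 => c p.1 * v p.1 p.2) F =
      (∏ i, c i ^ d i) * MvPolynomial.eval (fun p : ι × Fin 4 => v p.1 p.2) F := by
  rw [MvPolynomial.eval_eq', MvPolynomial.eval_eq', Finset.mul_sum]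
  refine Finset.sum_congr rfl fun m hm => ?_
  have hw := hF (MvPolynomial.mem_support_iff.mp hm)
  have hd : ∀ i, d i = ∑ j : Fin 4, m (i, j) := by
    intro i
    rw [← hw, Finsupp.weight_apply, Finsupp.sum_fintype _ _ (by simp), Finset.sum_apply,
      Fintype.sum_prod_type]
    rw [Finset.sum_eq_single i]
    · simp
    · intro b _ hb
      simp [Pi.single_eq_of_ne hb.symm]
    · simp
  have hc : ∏ p : ι × Fin 4, c p.1 ^ m p = ∏ i, c i ^ d i := by
    rw [Fintype.prod_prod_type]
    refine Finset.prod_congr rfl fun i _ => ?_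
    rw [hd i, ← Finset.prod_pow_eq_pow_sum]
  simp only [mul_pow, Finset.prod_mul_distrib, hc]
  ring

/-- For a multihomogeneous polynomial, vanishing may be tested on one choice of coordinates. -/
theorem vanishesAt_iff {ι : Type} [Fintype ι] [DecidableEq ι]
    {F : MvPolynomial (ι × Fin 4) ℂ} (hF : IsMultihomogeneous F) (x : MultiProj ι) :
    VanishesAt F x ↔ MvPolynomial.eval (fun p : ι × Fin 4 => (x p.1).rep p.2) F = 0 := by
  constructor
  · intro h
    exact h (fun i => (x i).rep)
      fun i => ⟨Projectivization.rep_nonzero (x i), Projectivization.mk_rep (x i)⟩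
  · intro h v hv
    obtain ⟨d, hd⟩ := hF
    have hs : ∀ i, ∃ c : ℂ, c • (x i).rep = v i := by
      intro i
      obtain ⟨h0, h1⟩ := hv i
      rw [← Projectivization.mk_rep (x i), Projectivization.mk_eq_mk_iff'] at h1
      exact h1
    choose c hc using hs
    have hv' : (fun p : ι × Fin 4 => v p.1 p.2) =
        fun p : ι × Fin 4 => c p.1 * (fun i => (x i).rep) p.1 p.2 := by
      funext p
      rw [← hc p.1]
      simp
    rw [hv']
    exact (eval_rescale hd c fun i => (x i).rep).trans (by rw [h, mul_zero])

/-- The Zariski topology on a finite product of projective spaces: the closed sets are the common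
zero loci of sets of multihomogeneous polynomials. -/
instance MultiProj.zariskiTopology {ι : Type} [Fintype ι] [DecidableEq ι] :
    TopologicalSpace (MultiProj ι) :=
  TopologicalSpace.ofClosed
    {Z | ∃ S : Set (MvPolynomial (ι × Fin 4) ℂ),
      (∀ F ∈ S, IsMultihomogeneous F) ∧ Z = projZeroLocus S}
    (by
      refine ⟨{1}, ?_, ?_⟩
      · rintro F rfl
        exact ⟨0, MvPolynomial.isWeightedHomogeneous_one ℂ _⟩
      · ext x
        simp only [Set.mem_empty_iff_false, projZeroLocus, Set.mem_ofPred_eq, Set.mem_singleton_iff,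
          forall_eq, false_iff]
        intro h
        simpa using h (fun i => (x i).rep)
          fun i => ⟨Projectivization.rep_nonzero (x i), Projectivization.mk_rep (x i)⟩)
    (by
      intro A hA
      choose S hS hZ using fun (Z : Set (MultiProj ι)) (h : Z ∈ A) => hA h
      refine ⟨⋃ Z, ⋃ h : Z ∈ A, S Z h, ?_, ?_⟩
      · intro F hF
        simp only [Set.mem_iUnion] at hF
        obtain ⟨Z, hZA, hFZ⟩ := hF
        exact hS Z hZA F hFZ
      · ext x
        simp only [Set.mem_sInter, projZeroLocus, Set.mem_iUnion, Set.mem_ofPred_eq]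
        constructor
        · rintro h F ⟨Z, hZA, hFZ⟩
          have := h Z hZA
          rw [hZ Z hZA] at this
          exact this F hFZ
        · intro h Z hZA
          rw [hZ Z hZA]
          exact fun F hF => h F ⟨Z, hZA, hF⟩)
    (by
      rintro _ ⟨S, hS, rfl⟩ _ ⟨T, hT, rfl⟩
      have hmul : ∀ F ∈ S, ∀ G ∈ T, IsMultihomogeneous (F * G) := by
        intro F hF G hG
        obtain ⟨d, hd⟩ := hS F hF
        obtain ⟨e, he⟩ := hT G hG
        exact ⟨d + e, hd.mul he⟩
      refine ⟨{P | ∃ F ∈ S, ∃ G ∈ T, P = F * G}, ?_, ?_⟩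
      · rintro _ ⟨F, hF, G, hG, rfl⟩
        exact hmul F hF G hG
      · ext x
        simp only [Set.mem_union, projZeroLocus, Set.mem_ofPred_eq]
        constructor
        · rintro (h | h) _ ⟨F, hF, G, hG, rfl⟩ v hv
          · rw [map_mul, h F hF v hv, zero_mul]
          · rw [map_mul, h G hG v hv, mul_zero]
        · intro h
          by_contra hcon
          push Not at hcon
          obtain ⟨⟨F, hF, hFx⟩, G, hG, hGx⟩ := hcon
          have hFG := (vanishesAt_iff (hmul F hF G hG) x).mp (h _ ⟨F, hF, G, hG, rfl⟩)
          rw [map_mul, mul_eq_zero] at hFG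
          rcases hFG with h1 | h1
          · exact hFx ((vanishesAt_iff (hS F hF) x).mpr h1)
          · exact hGx ((vanishesAt_iff (hT G hG) x).mpr h1))

/-- `A` is a projective camera (a `3 × 4` matrix of rank three) with center `a`. -/
def IsCameraWithCenter (A : Matrix (Fin 3) (Fin 4) ℂ) (a : P3) : Prop :=
  A.rank = 3 ∧ A.mulVec a.rep = 0

/-- Two tuples of (nonzero) vectors of `ℂ³` represent `SL(3)`-equivalent tuples of points
of `ℙ²`. -/
def SLEquivalent {n : ℕ} (p q : Fin n → Fin 3 → ℂ) : Prop :=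
  ∃ H : Matrix.SpecialLinearGroup (Fin 3) ℂ, ∀ i, ∃ c : ℂ, c ≠ 0 ∧
    p i = c • (H : Matrix (Fin 3) (Fin 3) ℂ).mulVec (q i)

/-- The locus of pairs of camera centers `(a, b) = (c 0, c 1)` for which there are cameras `A`, `B`
with these centers such that the images of `X` under `A` and of `Y` under `B` are well defined and
`SL(3)`-equivalent. -/
def centersLocus {n : ℕ} (X Y : Fin n → P3) : Set (MultiProj (Fin 2)) :=
  {c | ∃ A B : Matrix (Fin 3) (Fin 4) ℂ,
    IsCameraWithCenter A (c 0) ∧ IsCameraWithCenter B (c 1) ∧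
    (∀ i, A.mulVec (X i).rep ≠ 0) ∧ (∀ i, B.mulVec (Y i).rep ≠ 0) ∧
    SLEquivalent (fun i => A.mulVec (X i).rep) (fun i => B.mulVec (Y i).rep)}

/-- The centers-variety: the Zariski closure in `ℙ³ × ℙ³` of the locus of camera centers. -/
def centersVariety {n : ℕ} (X Y : Fin n → P3) : Set (MultiProj (Fin 2)) :=
  closure (centersLocus X Y)

/-- The union of the lines joining pairs of points of `X`, together with the points of `X`. -/
def secantLines {n : ℕ} (X : Fin n → P3) : Set P3 :=
  {a | ∃ i j, a.submodule ≤ (X i).submodule ⊔ (X j).submodule}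

/-- The variant of the centers-variety in which centers on a line through two world points are
left out of the locus before the closure is taken. -/
def centersVarietyOffLines {n : ℕ} (X Y : Fin n → P3) : Set (MultiProj (Fin 2)) :=
  closure {c ∈ centersLocus X Y | c 0 ∉ secantLines X ∧ c 1 ∉ secantLines Y}

/-- A property of pairs `(X, Y)` of ordered `n`-tuples of points of `ℙ³` holds generically: it
holds on a nonempty Zariski open subset of `(ℙ³)ⁿ × (ℙ³)ⁿ`. -/
def HoldsForGenericPair (n : ℕ) (P : (Fin n → P3) → (Fin n → P3) → Prop) : Prop :=
  ∃ U : Set (MultiProj (Fin n ⊕ Fin n)), IsOpen U ∧ U.Nonempty ∧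
    ∀ X Y : Fin n → P3, (Sum.elim X Y : Fin n ⊕ Fin n → P3) ∈ U → P X Y

/-!
Pairs of cameras `(A, B)` with `A xᵢ = μᵢ B yᵢ` are linear maps `(u, w) ↦ A u - B w` from `ℂ⁴ × ℂ⁴`
to `ℂ³` that kill the vectors `zᵢ = (xᵢ, μᵢ yᵢ)`. The centers `a`, `b` are given by the vectors
`(a, 0)` and `(0, b)` of the kernel, and such cameras exist as soon as the `zᵢ`, `(a, 0)` and
`(0, b)` lie in a subspace of dimension five (`mem_centersLocusOffLines_of_finrank_le`).

For `n = 4` the points are bases, and `a = ∑ αᵢ xᵢ`, `b = ∑ βᵢ yᵢ` with nonzero coefficients are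
centers for `μᵢ = -βᵢ / αᵢ`. Fewer points are completed to four.

For `n ≥ 5` the condition is dualized. The span of the `zᵢ` has dimension at most five if `n - 5`
independent linear relations of the `xᵢ` become relations of the `yᵢ` when their coefficients are
multiplied by `μᵢ`; the centers are then read off from one more relation on each side
(`mem_centersLocusOffLines_of_relations`). The relations are encoded by Gale duals `k`, `k'` of `x`,
`y`, with `n - 4` columns. A Gale dual is a polynomial function of the points, with an arbitrary
value at some base point (`exists_isGale`), so that a property holds generically if it holds for all
pairs of Gale duals in a Zariski neighbourhood of one pair (`holdsForGenericPair_of_isGale`).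

* For `n = 5` there is no condition on `μ`.
* For `n = 6` any relation of `x` and any relation of `y`, without zero entries, are matched by a
  unique `μ`; the two relations vary in projective lines.
* For `n = 7` two independent relations on each side have to be matched. This amounts to a singular
  `3 × 3` matrix `G` with `∑ G r s * k i r * k' i s = 0` for the seven indices `i`
  (`nonempty_centersLocusOffLines_of_seven`). Such `G` form a pencil (`sevenPencil`), on which the
  determinant is a cubic and so has a root. Some root satisfies the required open conditions: by a
  resultant argument (`eventually_exists_root`) this holds near a pair of Gale duals for which the
  cubic is a multiple of `t ^ 3` and the conditions hold at `t = 0`.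

For `n = 5` and `n = 6` the dimension is bounded by polynomial parametrizations: the images of
a flag of coordinate subspaces have irreducible closures, and these are distinguished by linear
conditions on one of the centers (`le_topologicalKrullDim_of_param`). For `n = 7` it is enough that
the locus is nonempty. All pairs of centers produced avoid the secant lines, by the requirement that
the coefficient vectors of `a` and `b` stay off the spaces of relations even after a change of two
entries (`sum_smul_ne_add`).
-/

/-! ### Polynomial functions and generic points of affine spaces -/

/-- `f` is a polynomial function on the affine space `σ → ℂ`. -/
@[fun_prop]
def IsPolyFun {σ : Type} (f : (σ → ℂ) → ℂ) : Prop :=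
  ∃ P : MvPolynomial σ ℂ, ∀ v, f v = MvPolynomial.eval v P

namespace IsPolyFun

variable {σ τ ι : Type} {f g : (σ → ℂ) → ℂ}

@[fun_prop]
theorem const (c : ℂ) : IsPolyFun fun _ : σ → ℂ => c := ⟨MvPolynomial.C c, by simp⟩

@[fun_prop]
theorem coord (i : σ) : IsPolyFun fun v : σ → ℂ => v i := ⟨MvPolynomial.X i, by simp⟩

@[fun_prop]
theorem add (hf : IsPolyFun f) (hg : IsPolyFun g) : IsPolyFun fun v => f v + g v := by
  obtain ⟨P, hP⟩ := hf
  obtain ⟨Q, hQ⟩ := hg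
  exact ⟨P + Q, by simp [hP, hQ]⟩

@[fun_prop]
theorem mul (hf : IsPolyFun f) (hg : IsPolyFun g) : IsPolyFun fun v => f v * g v := by
  obtain ⟨P, hP⟩ := hf
  obtain ⟨Q, hQ⟩ := hg
  exact ⟨P * Q, by simp [hP, hQ]⟩

@[fun_prop]
theorem neg (hf : IsPolyFun f) : IsPolyFun fun v => -f v := by
  obtain ⟨P, hP⟩ := hf
  exact ⟨-P, by simp [hP]⟩

@[fun_prop]
theorem sub (hf : IsPolyFun f) (hg : IsPolyFun g) : IsPolyFun fun v => f v - g v := by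
  simpa only [sub_eq_add_neg] using hf.add hg.neg

@[fun_prop]
theorem pow (hf : IsPolyFun f) (n : ℕ) : IsPolyFun fun v => f v ^ n := by
  obtain ⟨P, hP⟩ := hf
  exact ⟨P ^ n, by simp [hP]⟩

@[fun_prop]
theorem sum {s : Finset ι} {f : ι → (σ → ℂ) → ℂ} (hf : ∀ i, IsPolyFun (f i)) :
    IsPolyFun fun v => ∑ i ∈ s, f i v := by
  choose P hP using hf
  exact ⟨∑ i ∈ s, P i, by simp [hP]⟩

@[fun_prop]
theorem prod {s : Finset ι} {f : ι → (σ → ℂ) → ℂ} (hf : ∀ i, IsPolyFun (f i)) :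
    IsPolyFun fun v => ∏ i ∈ s, f i v := by
  choose P hP using hf
  exact ⟨∏ i ∈ s, P i, by simp [hP]⟩

theorem comp {f : (τ → ℂ) → ℂ} (hf : IsPolyFun f) {φ : (σ → ℂ) → τ → ℂ}
    (hφ : ∀ j, IsPolyFun fun v => φ v j) : IsPolyFun fun v => f (φ v) := by
  obtain ⟨P, hP⟩ := hf
  choose Q hQ using hφ
  refine ⟨MvPolynomial.bind₁ Q P, fun v => ?_⟩
  change f (φ v) = _
  rw [hP, ← MvPolynomial.coe_aeval_eq_eval, ← MvPolynomial.coe_aeval_eq_eval]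
  simp only [RingHom.coe_coe, MvPolynomial.aeval_bind₁]
  congr 2
  funext j
  exact (hQ j v).trans (congrFun (congrArg _ (MvPolynomial.coe_aeval_eq_eval v).symm) _)

@[fun_prop]
theorem det {n : Type} [Fintype n] [DecidableEq n] {M : (σ → ℂ) → Matrix n n ℂ}
    (hM : ∀ i j, IsPolyFun fun v => M v i j) : IsPolyFun fun v => (M v).det := by
  simp only [Matrix.det_apply']
  fun_prop

@[fun_prop]
theorem adjugate {n : Type} [Fintype n] [DecidableEq n] {M : (σ → ℂ) → Matrix n n ℂ}
    (hM : ∀ i j, IsPolyFun fun v => M v i j) (i j : n) : IsPolyFun fun v => (M v).adjugate i j := by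
  simp only [Matrix.adjugate_apply]
  refine det fun a b => ?_
  by_cases h : a = j
  · subst h; simp only [Matrix.updateRow_self]; exact const _
  · simp only [Matrix.updateRow_ne h]; exact hM a b

/-- The polynomial functions form a domain. -/
theorem exists_mul_ne_zero (hf : IsPolyFun f) (hg : IsPolyFun g) (hf0 : ∃ v, f v ≠ 0)
    (hg0 : ∃ v, g v ≠ 0) : ∃ v, f v * g v ≠ 0 := by
  obtain ⟨P, hP⟩ := hf
  obtain ⟨Q, hQ⟩ := hg
  by_contra! h
  have hPQ : P * Q = 0 := MvPolynomial.funext fun v => by simpa [hP, hQ] using h v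
  rcases mul_eq_zero.mp hPQ with rfl | rfl
  · obtain ⟨v, hv⟩ := hf0; simp [hP] at hv
  · obtain ⟨v, hv⟩ := hg0; simp [hQ] at hv

end IsPolyFun

/-- The filter of Zariski neighbourhoods of a point of the affine space `σ → ℂ`, generated by
the sets where a polynomial function with a nonzero value at the point does not vanish. -/
def zariskiNhds {σ : Type} (v₀ : σ → ℂ) : Filter (σ → ℂ) where
  sets := {S | ∃ f : (σ → ℂ) → ℂ, IsPolyFun f ∧ f v₀ ≠ 0 ∧ ∀ v, f v ≠ 0 → v ∈ S}
  univ_sets := ⟨fun _ => 1, .const 1, one_ne_zero, fun _ _ => trivial⟩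
  sets_of_superset := by
    rintro S T ⟨f, hf, h0, h⟩ hST
    exact ⟨f, hf, h0, fun v hv => hST (h v hv)⟩
  inter_sets := by
    rintro S T ⟨f, hf, hf0, hfS⟩ ⟨g, hg, hg0, hgT⟩
    exact ⟨fun v => f v * g v, hf.mul hg, mul_ne_zero hf0 hg0, fun v hv =>
      ⟨hfS v (left_ne_zero_of_mul hv), hgT v (right_ne_zero_of_mul hv)⟩⟩

section

variable {σ τ : Type}

theorem eventually_zariskiNhds {v₀ : σ → ℂ} {p : (σ → ℂ) → Prop} :
    (∀ᶠ v in zariskiNhds v₀, p v) ↔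
      ∃ f : (σ → ℂ) → ℂ, IsPolyFun f ∧ f v₀ ≠ 0 ∧ ∀ v, f v ≠ 0 → p v := Iff.rfl

theorem IsPolyFun.eventually_ne {f : (σ → ℂ) → ℂ} (hf : IsPolyFun f) {v₀ : σ → ℂ} (h : f v₀ ≠ 0) :
    ∀ᶠ v in zariskiNhds v₀, f v ≠ 0 :=
  eventually_zariskiNhds.mpr ⟨f, hf, h, fun _ => id⟩

theorem tendsto_zariskiNhds {φ : (σ → ℂ) → τ → ℂ} (hφ : ∀ j, IsPolyFun fun v => φ v j)
    {v₀ : σ → ℂ} {w₀ : τ → ℂ} (h : φ v₀ = w₀) :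
    Filter.Tendsto φ (zariskiNhds v₀) (zariskiNhds w₀) := by
  rintro S ⟨f, hf, hf0, hfS⟩
  exact ⟨fun v => f (φ v), hf.comp hφ, by simpa only [h] using hf0, fun v hv => hfS _ hv⟩

/-- A root of a polynomial whose coefficients depend polynomially on `v`: if at `v₀` the only root
is `t = 0`, then for generic `v` there is a root, and every property that holds for generic `(t, v)`
near `(0, v₀)` holds at it. The reason is that the resultant with a polynomial `g` not vanishing at
`(0, v₀)` is nonzero at `v₀`. The variable `t` is the coordinate `none`. -/
theorem eventually_exists_root {d : ℕ} (hd : d ≠ 0) {c : Fin (d + 1) → (σ → ℂ) → ℂ}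
    (hc : ∀ i, IsPolyFun (c i)) {v₀ : σ → ℂ} (h0 : ∀ i, c i v₀ = 0 ↔ i ≠ Fin.last d)
    {p : (Option σ → ℂ) → Prop}
    (hp : ∀ᶠ w in zariskiNhds (fun o : Option σ => o.elim 0 v₀), p w) :
    ∀ᶠ v in zariskiNhds v₀, ∃ t : ℂ, ∑ i, c i v * t ^ (i : ℕ) = 0 ∧
      p (fun o => o.elim t v) := by
  obtain ⟨g, ⟨G, hG⟩, hg0, hgp⟩ := eventually_zariskiNhds.mp hp
  choose C hC using hc
  -- Over the polynomials in `v`, take the resultant of `∑ cᵢ tⁱ` and `g`, both polynomials in `t`.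
  let f : Polynomial (MvPolynomial σ ℂ) := ∑ i, Polynomial.C (C i) * Polynomial.X ^ (i : ℕ)
  let g' : Polynomial (MvPolynomial σ ℂ) := MvPolynomial.optionEquivLeft ℂ σ G
  have hfd : f.natDegree ≤ d := by
    refine Polynomial.natDegree_sum_le_of_forall_le _ _ fun i _ => ?_
    exact (Polynomial.natDegree_C_mul_X_pow_le _ _).trans (Nat.lt_succ_iff.mp i.2)
  have hfv : ∀ v, f.map (MvPolynomial.eval v) =
      ∑ i, Polynomial.C (c i v) * Polynomial.X ^ (i : ℕ) := by
    intro v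
    simp [f, Polynomial.map_sum, hC]
  have hgv : ∀ v t, (g'.map (MvPolynomial.eval v)).eval t = g (fun o => o.elim t v) := by
    intro v t
    rw [hG, ← MvPolynomial.optionEquivLeft_elim_eval]
  set m := g'.natDegree
  let R : (σ → ℂ) → ℂ := fun v => MvPolynomial.eval v (Polynomial.resultant f g' d m)
  have hR : ∀ v, R v = Polynomial.resultant (f.map (MvPolynomial.eval v))
      (g'.map (MvPolynomial.eval v)) d m := fun v => (Polynomial.resultant_map_map ..).symm
  have hR0 : R v₀ ≠ 0 := by
    have h1 : f.map (MvPolynomial.eval v₀) =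
        Polynomial.C (c (Fin.last d) v₀) * Polynomial.X ^ d := by
      rw [hfv, Finset.sum_eq_single (Fin.last d)]
      · simp
      · intro i _ hi
        simp [(h0 i).mpr hi]
      · simp
    rw [hR, h1, Polynomial.resultant_C_mul_left, Polynomial.resultant_X_pow_left]
    · refine mul_ne_zero (pow_ne_zero _ fun h => (h0 _).mp h rfl) ?_
      rw [Polynomial.coeff_zero_eq_eval_zero, hgv]
      exact pow_ne_zero _ hg0
    · exact Polynomial.natDegree_map_le
  have hlast : c (Fin.last d) v₀ ≠ 0 := fun h => (h0 _).mp h rfl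
  have e1 : ∀ᶠ v in zariskiNhds v₀, R v ≠ 0 :=
    IsPolyFun.eventually_ne ⟨_, fun v => rfl⟩ hR0
  have e2 : ∀ᶠ v in zariskiNhds v₀, c (Fin.last d) v ≠ 0 :=
    IsPolyFun.eventually_ne ⟨_, hC _⟩ hlast
  filter_upwards [e1, e2] with v hv1 hv2
  have hdeg : (f.map (MvPolynomial.eval v)).coeff d = c (Fin.last d) v := by
    rw [hfv, Polynomial.finsetSum_coeff, Finset.sum_eq_single (Fin.last d)]
    · simp
    · intro i _ hi
      have : d ≠ i := fun h => hi (Fin.ext h.symm)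
      simp [Polynomial.coeff_X_pow, this]
    · simp
  obtain ⟨t, ht⟩ : ∃ t, (f.map (MvPolynomial.eval v)).IsRoot t := by
    refine IsAlgClosed.exists_root _ fun h => ?_
    rw [← hdeg] at hv2
    exact hd (Nat.le_zero.mp ((Polynomial.le_natDegree_of_ne_zero hv2).trans
      (Polynomial.natDegree_eq_of_degree_eq_some h).le))
  refine ⟨t, ?_, hgp _ fun hgt => hv1 ?_⟩
  · simpa [hfv, Polynomial.eval_finsetSum, Polynomial.IsRoot] using ht
  · obtain ⟨a, b, -, -, hab⟩ := Polynomial.exists_mul_add_mul_eq_C_resultant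
      (f.map (MvPolynomial.eval v)) (g'.map (MvPolynomial.eval v))
      (Polynomial.natDegree_map_le.trans hfd) (Polynomial.natDegree_map_le (p := g'))
      (by left; exact hd)
    rw [hR]
    have := congrArg (Polynomial.eval t) hab
    rw [← hgv] at hgt
    simpa [ht.eq_zero, hgt] using this.symm

end

/-! ### The Zariski topology and dimension in products of projective spaces -/

section

variable {ι : Type}

/-- `v` consists of homogeneous coordinates of the points `x i`. -/
def IsCoords (v : ι → Fin 4 → ℂ) (x : MultiProj ι) : Prop :=
  ∀ i, ∃ h : v i ≠ 0, Projectivization.mk ℂ (v i) h = x i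

theorem IsIrreducible.preimage_subtypeVal {T : Type*} [TopologicalSpace T] {s V : Set T}
    (hs : IsIrreducible s) (hsV : s ⊆ V) : IsIrreducible (Subtype.val ⁻¹' s : Set V) := by
  constructor
  · obtain ⟨x, hx⟩ := hs.nonempty
    exact ⟨⟨x, hsV hx⟩, hx⟩
  · rintro _ _ ⟨U, hU, rfl⟩ ⟨W, hW, rfl⟩ ⟨x, hxs, hxU⟩ ⟨y, hys, hyW⟩
    obtain ⟨z, hzs, hz⟩ := hs.isPreirreducible U W hU hW ⟨x, hxs, hxU⟩ ⟨y, hys, hyW⟩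
    exact ⟨⟨z, hsV hzs⟩, hzs, hz⟩

theorem isCoords_mk {v : ι → Fin 4 → ℂ} (hv : ∀ i, v i ≠ 0) :
    IsCoords v fun i => Projectivization.mk ℂ (v i) (hv i) :=
  fun i => ⟨hv i, rfl⟩

theorem isCoords_rep (x : MultiProj ι) : IsCoords (fun i => (x i).rep) x :=
  fun i => ⟨(x i).rep_nonzero, (x i).mk_rep⟩

theorem IsCoords.smul {v : ι → Fin 4 → ℂ} {x : MultiProj ι} (hv : IsCoords v x) {c : ι → ℂ}
    (hc : ∀ i, c i ≠ 0) : IsCoords (fun i => c i • v i) x := by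
  intro i
  obtain ⟨h, hx⟩ := hv i
  refine ⟨smul_ne_zero (hc i) h, ?_⟩
  rw [← hx, Projectivization.mk_eq_mk_iff']
  exact ⟨c i, rfl⟩

theorem IsCoords.exists_rep_eq {v : ι → Fin 4 → ℂ} {x : MultiProj ι} (hv : IsCoords v x) (i : ι) :
    ∃ c : ℂ, c ≠ 0 ∧ (x i).rep = c • v i := by
  obtain ⟨h, hx⟩ := hv i
  have h1 := (Projectivization.mk_rep (x i)).trans hx.symm
  rw [Projectivization.mk_eq_mk_iff'] at h1
  obtain ⟨c, hc⟩ := h1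
  refine ⟨c, ?_, hc.symm⟩
  rintro rfl
  exact (x i).rep_nonzero (by rw [← hc, zero_smul])

variable [Fintype ι] [DecidableEq ι]

theorem isClosed_multiProj_iff {Z : Set (MultiProj ι)} :
    IsClosed Z ↔ ∃ S : Set (MvPolynomial (ι × Fin 4) ℂ),
      (∀ F ∈ S, IsMultihomogeneous F) ∧ Z = projZeroLocus S := by
  rw [← isOpen_compl_iff]
  change Zᶜᶜ ∈ _ ↔ _
  rw [compl_compl]
  rfl

theorem isClosed_setOf_vanishesAt_of_isMultihomogeneous {F : MvPolynomial (ι × Fin 4) ℂ}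
    (hF : IsMultihomogeneous F) : IsClosed {x : MultiProj ι | VanishesAt F x} :=
  isClosed_multiProj_iff.mpr ⟨{F}, by simpa using hF, by ext; simp [projZeroLocus]⟩

/-- If a polynomial vanishes at all homogeneous coordinates of a point, so do its multihomogeneous
components. -/
theorem VanishesAt.weightedHomogeneousComponent {F : MvPolynomial (ι × Fin 4) ℂ} {x : MultiProj ι}
    (hF : VanishesAt F x) (d : ι → ℕ) :
    VanishesAt (MvPolynomial.weightedHomogeneousComponent
      (fun p : ι × Fin 4 => (Pi.single p.1 1 : ι → ℕ)) d F) x := by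
  intro v hv
  set w := fun p : ι × Fin 4 => (Pi.single p.1 1 : ι → ℕ)
  have hfin : (Function.support fun e =>
      MvPolynomial.weightedHomogeneousComponent w e F).Finite :=
    MvPolynomial.weightedHomogeneousComponent_finsupp F
  -- The value at `(cᵢ vᵢ)` as a polynomial in `c`; its coefficients are the values of the
  -- components.
  let Q : MvPolynomial ι ℂ := ∑ e ∈ hfin.toFinset,
    MvPolynomial.monomial (Finsupp.equivFunOnFinite.symm e)
      (MvPolynomial.eval (fun p => v p.1 p.2) (MvPolynomial.weightedHomogeneousComponent w e F))
  have hQ : ∀ c : ι → ℂ, MvPolynomial.eval c Q =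
      MvPolynomial.eval (fun p : ι × Fin 4 => c p.1 * v p.1 p.2) F := by
    intro c
    conv_rhs => rw [← MvPolynomial.sum_weightedHomogeneousComponent w F, finsum_eq_sum _ hfin]
    rw [map_sum, map_sum]
    refine Finset.sum_congr rfl fun e _ => ?_
    rw [eval_rescale (MvPolynomial.weightedHomogeneousComponent_isWeightedHomogeneous e F),
      MvPolynomial.eval_monomial, mul_comm, Finsupp.prod_fintype _ _ (by simp)]
    rfl
  have hQ0 : Q * ∏ i, MvPolynomial.X i = 0 := by
    refine MvPolynomial.funext fun c => ?_
    rw [map_mul, map_prod, map_zero, hQ, mul_eq_zero]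
    by_cases hc : ∀ i, c i ≠ 0
    · left
      exact hF (fun i => c i • v i) (IsCoords.smul hv hc)
    · right
      push Not at hc
      obtain ⟨i, hi⟩ := hc
      exact Finset.prod_eq_zero (Finset.mem_univ i) (by simpa using hi)
  have hQ1 : Q = 0 := (mul_eq_zero.mp hQ0).resolve_right
    (Finset.prod_ne_zero_iff.mpr fun i _ => MvPolynomial.X_ne_zero i)
  by_contra hne
  have hd : d ∈ hfin.toFinset := by
    rw [Set.Finite.mem_toFinset, Function.mem_support]
    intro h
    simp [h] at hne
  have hcoeff := congrArg (MvPolynomial.coeff (Finsupp.equivFunOnFinite.symm d)) hQ1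
  rw [MvPolynomial.coeff_sum, Finset.sum_eq_single d] at hcoeff
  · rw [MvPolynomial.coeff_monomial, if_pos rfl] at hcoeff
    exact hne hcoeff
  · intro e _ he
    rw [MvPolynomial.coeff_monomial, if_neg]
    exact fun h => he (Finsupp.equivFunOnFinite.symm.injective h)
  · exact fun h => absurd hd h

/-- The polynomial need not be multihomogeneous, since `VanishesAt` tests all homogeneous
coordinates. -/
theorem isClosed_setOf_vanishesAt (F : MvPolynomial (ι × Fin 4) ℂ) :
    IsClosed {x : MultiProj ι | VanishesAt F x} := by
  set w := fun p : ι × Fin 4 => (Pi.single p.1 1 : ι → ℕ)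
  have : {x : MultiProj ι | VanishesAt F x} =
      ⋂ d, {x | VanishesAt (MvPolynomial.weightedHomogeneousComponent w d F) x} := by
    ext x
    simp only [Set.mem_iInter]
    refine ⟨fun h d => h.weightedHomogeneousComponent d, fun h v hv => ?_⟩
    rw [← MvPolynomial.sum_weightedHomogeneousComponent w F,
      finsum_eq_sum _ (MvPolynomial.weightedHomogeneousComponent_finsupp (w := w) F), map_sum]
    exact Finset.sum_eq_zero fun e _ => h e v hv
  rw [this]
  exact isClosed_iInter fun d => isClosed_setOf_vanishesAt_of_isMultihomogeneous
    ⟨d, MvPolynomial.weightedHomogeneousComponent_isWeightedHomogeneous d F⟩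

/-- A property of pairs of tuples of points holds generically as soon as it holds for all
homogeneous coordinates in a Zariski neighbourhood of some point. -/
theorem holdsForGenericPair_of_eventually {n : ℕ} {P : (Fin n → P3) → (Fin n → P3) → Prop}
    {v₀ : (Fin n ⊕ Fin n) × Fin 4 → ℂ}
    (h : ∀ᶠ v in zariskiNhds v₀, ∀ X Y, IsCoords (fun i j => v (.inl i, j)) X →
      IsCoords (fun i j => v (.inr i, j)) Y → P X Y) : HoldsForGenericPair n P := by
  obtain ⟨f, ⟨F, hF⟩, hf0, hP⟩ := eventually_zariskiNhds.mp h
  refine ⟨{x | VanishesAt F x}ᶜ, (isClosed_setOf_vanishesAt F).isOpen_compl, ?_, ?_⟩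
  · obtain ⟨v, hv⟩ := IsPolyFun.exists_mul_ne_zero (f := f)
      (g := fun v : (Fin n ⊕ Fin n) × Fin 4 → ℂ => ∏ i, v (i, 0)) ⟨F, hF⟩
      (by fun_prop) ⟨v₀, hf0⟩ ⟨fun _ => 1, by simp⟩
    have hv' : ∀ i, (fun j => v (i, j)) ≠ 0 := fun i hi =>
      Finset.prod_ne_zero_iff.mp (right_ne_zero_of_mul hv) i (Finset.mem_univ i) (congrFun hi 0)
    refine ⟨fun i => Projectivization.mk ℂ _ (hv' i), fun hvan => left_ne_zero_of_mul hv ?_⟩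
    rw [hF]
    exact hvan (fun i j => v (i, j)) (isCoords_mk hv')
  · intro X Y hXY
    rw [Set.mem_compl_iff, Set.mem_ofPred_eq, VanishesAt] at hXY
    push Not at hXY
    obtain ⟨v, hv, hvF⟩ := hXY
    refine hP (fun p => v p.1 p.2) (by rwa [hF]) X Y (fun i => hv (.inl i)) fun i => hv (.inr i)

/-- Membership of the coordinates of one factor in a linear subspace is a closed condition. -/
theorem isClosed_setOf_rep_mem (i : ι) (U : Submodule ℂ (Fin 4 → ℂ)) :
    IsClosed {x : MultiProj ι | (x i).rep ∈ U} := by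
  have : {x : MultiProj ι | (x i).rep ∈ U} = ⋂ ℓ : U.dualAnnihilator,
      {x | VanishesAt (∑ j, MvPolynomial.C (ℓ.1 (Pi.single j 1)) * MvPolynomial.X (i, j)) x} := by
    ext x
    simp only [Set.mem_ofPred_eq, Set.mem_iInter]
    have heval : ∀ (ℓ : Module.Dual ℂ (Fin 4 → ℂ)) (v : ι → Fin 4 → ℂ),
        MvPolynomial.eval (fun p => v p.1 p.2)
          (∑ j, MvPolynomial.C (ℓ (Pi.single j 1)) * MvPolynomial.X (i, j)) = ℓ (v i) := by
      intro ℓ v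
      rw [LinearMap.pi_apply_eq_sum_univ ℓ (v i)]
      simp only [map_sum, map_mul, MvPolynomial.eval_C, MvPolynomial.eval_X, smul_eq_mul]
      refine Finset.sum_congr rfl fun j _ => ?_
      rw [mul_comm]
      congr 2
      ext l
      simp [Pi.single_apply, eq_comm]
    constructor
    · intro hx ℓ v hv
      rw [heval]
      obtain ⟨c, hc, hr⟩ := IsCoords.exists_rep_eq hv i
      rw [hr, Submodule.smul_mem_iff _ hc] at hx
      exact (Submodule.mem_dualAnnihilator _).mp ℓ.2 _ hx
    · intro h
      rw [← Subspace.dualAnnihilator_dualCoannihilator_eq (W := U),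
        Submodule.mem_dualCoannihilator]
      intro ℓ hℓ
      exact (heval ℓ _).symm.trans (h ⟨ℓ, hℓ⟩ _ (isCoords_rep x))
  rw [this]
  exact isClosed_iInter fun ℓ => isClosed_setOf_vanishesAt _

/-- The points with coordinates `Φ s`, for `s` in the open set `D ≠ 0`. -/
def paramImage {σ : Type} (Φ : (σ → ℂ) → ι → Fin 4 → ℂ) (D : (σ → ℂ) → ℂ) : Set (MultiProj ι) :=
  {x | ∃ s, D s ≠ 0 ∧ IsCoords (Φ s) x}

/-- The image of a nonempty open subset of an affine space under a polynomial map is irreducible. -/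
theorem isIrreducible_paramImage {σ : Type} {Φ : (σ → ℂ) → ι → Fin 4 → ℂ} {D : (σ → ℂ) → ℂ}
    (hΦ : ∀ i j, IsPolyFun fun s => Φ s i j) (hD : IsPolyFun D) (hD0 : ∃ s, D s ≠ 0)
    (hΦ0 : ∀ s, D s ≠ 0 → ∀ i, Φ s i ≠ 0) : IsIrreducible (paramImage Φ D) := by
  -- A nonempty open subset of the image contains the image of a principal open set.
  have key : ∀ U : Set (MultiProj ι), IsOpen U → (paramImage Φ D ∩ U).Nonempty →
      ∃ f : (σ → ℂ) → ℂ, IsPolyFun f ∧ (∃ s, f s ≠ 0) ∧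
        ∀ s, f s ≠ 0 → ∀ x, IsCoords (Φ s) x → x ∈ U := by
    rintro U hU ⟨x, ⟨s, hs, hx⟩, hxU⟩
    obtain ⟨S, hS, hUS⟩ := isClosed_multiProj_iff.mp hU.isClosed_compl
    have hxU' : x ∉ projZeroLocus S := by rw [← hUS]; simpa using hxU
    simp only [projZeroLocus, Set.mem_ofPred_eq, not_forall] at hxU'
    obtain ⟨F, hF, hFx⟩ := hxU'
    refine ⟨fun s => MvPolynomial.eval (fun p : ι × Fin 4 => Φ s p.1 p.2) F,
      IsPolyFun.comp (f := fun v => MvPolynomial.eval v F) ⟨F, fun _ => rfl⟩ fun p => hΦ p.1 p.2,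
      ⟨s, fun h0 => hFx ?_⟩, fun s hs x hx => ?_⟩
    · obtain ⟨d, hd⟩ := hS F hF
      intro v hv
      have : ∀ i, ∃ c : ℂ, v i = c • Φ s i := by
        intro i
        obtain ⟨c, hc, h1⟩ := IsCoords.exists_rep_eq hv i
        obtain ⟨e, he, h2⟩ := hx.exists_rep_eq i
        refine ⟨c⁻¹ * e, ?_⟩
        rw [mul_smul, ← h2, h1, smul_smul, inv_mul_cancel₀ hc, one_smul]
      choose c hc using this
      have := eval_rescale hd c (Φ s)
      simp only [hc, Pi.smul_apply, smul_eq_mul]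
      exact this.trans (mul_eq_zero_of_right _ h0)
    · by_contra hxU
      have : x ∈ projZeroLocus S := by rw [← hUS]; exact hxU
      exact hs (this F hF _ hx)
  constructor
  · obtain ⟨s, hs⟩ := hD0
    exact ⟨_, s, hs, isCoords_mk (hΦ0 s hs)⟩
  · intro U V hU hV hSU hSV
    obtain ⟨f, hf, hf0, hfU⟩ := key U hU hSU
    obtain ⟨g, hg, hg0, hgV⟩ := key V hV hSV
    obtain ⟨s, hs⟩ := (hf.mul hg).exists_mul_ne_zero hD (hf.exists_mul_ne_zero hg hf0 hg0) hD0
    have hfg := left_ne_zero_of_mul hs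
    have hx := isCoords_mk (hΦ0 s (right_ne_zero_of_mul hs))
    exact ⟨_, ⟨s, right_ne_zero_of_mul hs, hx⟩, hfU s (left_ne_zero_of_mul hfg) _ hx,
      hgV s (right_ne_zero_of_mul hfg) _ hx⟩

/-- A flag of irreducible subsets, each of whose strict inclusions is witnessed by a linear
condition on one of the factors, bounds the dimension of the closure from below. -/
theorem le_topologicalKrullDim_closure {m : ℕ} {L : Set (MultiProj ι)}
    {I : Fin (m + 1) → Set (MultiProj ι)} (hI : ∀ k, IsIrreducible (I k)) (hmono : Monotone I)
    (hL : ∀ k, I k ⊆ L)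
    (hstrict : ∀ k : Fin m, ∃ (i : ι) (U : Submodule ℂ (Fin 4 → ℂ)),
      (∀ x ∈ I k.castSucc, (x i).rep ∈ U) ∧ ∃ x ∈ I k.succ, (x i).rep ∉ U) :
    (m : WithBot ℕ∞) ≤ topologicalKrullDim (closure L) := by
  let J : Fin (m + 1) → TopologicalSpace.IrreducibleCloseds (closure L) := fun k =>
    { carrier := Subtype.val ⁻¹' closure (I k)
      isIrreducible' := (hI k).closure.preimage_subtypeVal (closure_mono (hL k))
      isClosed' := isClosed_closure.preimage continuous_subtype_val }
  have hJ : StrictMono J := by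
    rw [Fin.strictMono_iff_lt_succ]
    intro k
    obtain ⟨i, U, h1, x, hx, hxU⟩ := hstrict k
    refine lt_of_le_of_ne (fun y hy => closure_mono (hmono k.castSucc_lt_succ.le) hy) fun heq => ?_
    have hx' : (⟨x, subset_closure (hL _ hx)⟩ : closure L) ∈ J k.succ := subset_closure hx
    rw [← heq] at hx'
    exact hxU (closure_minimal h1 (isClosed_setOf_rep_mem i U) hx')
  exact Order.LTSeries.length_le_krullDim (LTSeries.mk m J hJ)

end

/-- Dimension bound for the closure of a set containing the image of a polynomial map from an open
subset of `Fin m → ℂ`. The flag is the one of coordinate subspaces through the base point `s₀`; that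
the images of two successive subspaces differ is witnessed by a linear subspace of `ℂ⁴`. -/
theorem le_topologicalKrullDim_of_param {ι : Type} [Fintype ι] [DecidableEq ι] {m : ℕ}
    {L : Set (MultiProj ι)} {Φ : (Fin m → ℂ) → ι → Fin 4 → ℂ} {D : (Fin m → ℂ) → ℂ}
    (hΦ : ∀ i j, IsPolyFun fun s => Φ s i j) (hD : IsPolyFun D) (s₀ : Fin m → ℂ) (hD0 : D s₀ ≠ 0)
    (hΦ0 : ∀ s, D s ≠ 0 → ∀ i, Φ s i ≠ 0) (hL : ∀ s, D s ≠ 0 → ∀ x, IsCoords (Φ s) x → x ∈ L)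
    (hstrict : ∀ k : Fin m, ∃ (i : ι) (U : Submodule ℂ (Fin 4 → ℂ)),
      (∀ s, D s ≠ 0 → (∀ l, k ≤ l → s l = s₀ l) → Φ s i ∈ U) ∧
        ∃ s, D s ≠ 0 ∧ (∀ l, k < l → s l = s₀ l) ∧ Φ s i ∉ U) :
    (m : WithBot ℕ∞) ≤ topologicalKrullDim (closure L) := by
  -- The projection of the parameter space to its `k`-th coordinate subspace through `s₀`.
  let r : ℕ → (Fin m → ℂ) → Fin m → ℂ := fun k s l => if (l : ℕ) < k then s l else s₀ l
  have hr : ∀ k l, IsPolyFun fun s => r k s l := by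
    intro k l
    by_cases h : (l : ℕ) < k
    · simp only [r, if_pos h]; fun_prop
    · simp only [r, if_neg h]; fun_prop
  have hr0 : ∀ k, r k s₀ = s₀ := fun k => by ext l; simp [r]
  have hrr : ∀ k s, (∀ l : Fin m, k ≤ (l : ℕ) → s l = s₀ l) → r k s = s := by
    intro k s h
    ext l
    by_cases hl : (l : ℕ) < k
    · simp [r, hl]
    · simp [r, hl, h l (not_lt.mp hl)]
  have hrmem : ∀ k s, ∀ l : Fin m, k ≤ (l : ℕ) → r k s l = s₀ l := fun k s l hl => by
    simp [r, not_lt.mpr hl]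
  refine le_topologicalKrullDim_closure
    (I := fun k : Fin (m + 1) => paramImage (fun s => Φ (r k s)) fun s => D (r k s)) ?_ ?_ ?_ ?_
  · intro k
    exact isIrreducible_paramImage (fun i j => (hΦ i j).comp (hr k)) (hD.comp (hr k))
      ⟨s₀, by rwa [hr0]⟩ fun s hs => hΦ0 _ hs
  · rintro a b hab x ⟨s, hs, hx⟩
    have : r b (r a s) = r a s := hrr _ _ fun l hl => hrmem _ _ _ (le_trans hab hl)
    exact ⟨r a s, by simpa only [this] using hs, by simpa only [this] using hx⟩
  · rintro k x ⟨s, hs, hx⟩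
    exact hL _ hs x hx
  · intro k
    obtain ⟨i, U, h1, s, hs, hs0, hsU⟩ := hstrict k
    refine ⟨i, U, ?_, ?_⟩
    · rintro x ⟨s, hs, hx⟩
      obtain ⟨c, -, hr⟩ := hx.exists_rep_eq i
      rw [hr]
      exact U.smul_mem c (h1 _ hs fun l hl => hrmem _ _ _ hl)
    · have : r k.succ s = s := hrr _ _ fun l hl => hs0 l (by simpa [Nat.succ_le_iff] using hl)
      have hx := isCoords_mk (hΦ0 s hs)
      refine ⟨_, ⟨s, by simpa only [this] using hs, by simpa only [this] using hx⟩, ?_⟩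
      obtain ⟨c, hc, hr⟩ := hx.exists_rep_eq i
      rwa [hr, U.smul_mem_iff hc]

/-! ### Camera centers and linear relations -/

/-- The locus whose closure is `centersVarietyOffLines`. -/
def centersLocusOffLines {n : ℕ} (X Y : Fin n → P3) : Set (MultiProj (Fin 2)) :=
  {c ∈ centersLocus X Y | c 0 ∉ secantLines X ∧ c 1 ∉ secantLines Y}

theorem mem_secantLines_iff {n : ℕ} {x : Fin n → Fin 4 → ℂ} {X : Fin n → P3} (hX : IsCoords x X)
    {ι : Type} {v : ι → Fin 4 → ℂ} {c : MultiProj ι} (hc : IsCoords v c) (k : ι) :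
    c k ∈ secantLines X ↔ ∃ i j, ∃ p q : ℂ, v k = p • x i + q • x j := by
  obtain ⟨hv, hvc⟩ := hc k
  refine exists_congr fun i => exists_congr fun j => ?_
  obtain ⟨hi, hi'⟩ := hX i
  obtain ⟨hj, hj'⟩ := hX j
  rw [← hvc, ← hi', ← hj', Projectivization.submodule_mk, Projectivization.submodule_mk,
    Projectivization.submodule_mk, Submodule.span_singleton_le_iff_mem, Submodule.mem_sup]
  simp only [Submodule.mem_span_singleton]
  constructor
  · rintro ⟨_, ⟨p, rfl⟩, _, ⟨q, rfl⟩, h⟩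
    exact ⟨p, q, h.symm⟩
  · rintro ⟨p, q, h⟩
    exact ⟨_, ⟨p, rfl⟩, _, ⟨q, rfl⟩, h.symm⟩

/-- A camera maps no vector to zero except the multiples of its center. -/
theorem Matrix.mulVec_ne_zero_of_rank_eq_three {A : Matrix (Fin 3) (Fin 4) ℂ} (hA : A.rank = 3)
    {a : Fin 4 → ℂ} (ha : A.mulVec a = 0) {w : Fin 4 → ℂ} (hw : w ≠ 0)
    (h : ∀ p : ℂ, a ≠ p • w) : A.mulVec w ≠ 0 := by
  intro hAw
  have hker : Module.finrank ℂ A.mulVecLin.ker = 1 := by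
    have := A.mulVecLin.finrank_range_add_finrank_ker
    rw [← Matrix.rank, hA, Module.finrank_fin_fun] at this
    omega
  obtain ⟨p, hp⟩ := (finrank_eq_one_iff_of_nonzero' (⟨w, hAw⟩ : A.mulVecLin.ker)
    (fun h => hw (congrArg Subtype.val h))).mp hker ⟨a, ha⟩
  exact h p (congrArg Subtype.val hp).symm

/-- Pairs of cameras `(A, B)` with `A xᵢ = μᵢ B yᵢ` are the linear maps `ℂ⁴ × ℂ⁴ → ℂ³`,
`(u, w) ↦ A u - B w`, that kill the vectors `(xᵢ, μᵢ yᵢ)`; the centers are read off from the vectors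
`(a, 0)` and `(0, b)` in the kernel. Hence such cameras exist once all these vectors lie in a
subspace of dimension at most five. -/
theorem mem_centersLocusOffLines_of_finrank_le {n : ℕ} {x y : Fin n → Fin 4 → ℂ} {X Y : Fin n → P3}
    (hX : IsCoords x X) (hY : IsCoords y Y) (hxs : Submodule.span ℂ (Set.range x) = ⊤)
    (hys : Submodule.span ℂ (Set.range y) = ⊤) {a b : Fin 4 → ℂ} {c : MultiProj (Fin 2)}
    (hc : IsCoords ![a, b] c) {μ : Fin n → ℂ} (hμ : ∀ i, μ i ≠ 0)
    {V : Submodule ℂ ((Fin 4 → ℂ) × (Fin 4 → ℂ))} (hV : Module.finrank ℂ V ≤ 5)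
    (hz : ∀ i, (x i, μ i • y i) ∈ V) (ha : (a, 0) ∈ V) (hb : (0, b) ∈ V)
    (hax : ∀ i j, ∀ p q : ℂ, a ≠ p • x i + q • x j)
    (hby : ∀ i j, ∀ p q : ℂ, b ≠ p • y i + q • y j) : c ∈ centersLocusOffLines X Y := by
  have hdim : 3 ≤ Module.finrank ℂ V.dualAnnihilator := by
    have := Subspace.finrank_add_finrank_dualAnnihilator_eq V
    rw [Module.finrank_prod, Module.finrank_fin_fun] at this
    omega
  obtain ⟨f, hf⟩ := exists_linearIndependent_of_le_finrank hdim
  have hfV : ∀ r, ∀ z ∈ V, (f r).1 z = 0 := fun r z hz =>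
    (Submodule.mem_dualAnnihilator _).mp (f r).2 z hz
  let A : Matrix (Fin 3) (Fin 4) ℂ :=
    LinearMap.toMatrix' (LinearMap.pi fun r => (f r).1 ∘ₗ LinearMap.inl ℂ (Fin 4 → ℂ) (Fin 4 → ℂ))
  let B : Matrix (Fin 3) (Fin 4) ℂ :=
    -LinearMap.toMatrix' (LinearMap.pi fun r => (f r).1 ∘ₗ LinearMap.inr ℂ (Fin 4 → ℂ) (Fin 4 → ℂ))
  have hA : ∀ v r, A.mulVec v r = (f r).1 (v, 0) := fun v r => by
    simp [A, LinearMap.toMatrix'_mulVec]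
  have hB : ∀ v r, B.mulVec v r = -(f r).1 (0, v) := fun v r => by
    simp [B, LinearMap.toMatrix'_mulVec, Matrix.neg_mulVec]
  have hAB : ∀ i, A.mulVec (x i) = μ i • B.mulVec (y i) := by
    intro i
    ext r
    have h1 := hfV r _ (hz i)
    have h2 : (x i, μ i • y i) = (x i, 0) + μ i • ((0, y i) : (Fin 4 → ℂ) × (Fin 4 → ℂ)) := by simp
    rw [h2, map_add, map_smul, smul_eq_mul] at h1
    rw [Pi.smul_apply, hA, hB, smul_eq_mul]
    linear_combination h1
  -- The rows of `A` are independent: a combination vanishing on all `xᵢ` vanishes on all `yᵢ` too.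
  have hindep : ∀ g : Fin 3 → ℂ, (∀ i, ∑ r, g r * (f r).1 (x i, 0) = 0) →
      (∀ i, ∑ r, g r * (f r).1 (0, y i) = 0) → g = 0 := by
    intro g h1 h2
    have hl : (∑ r, g r • (f r).1) = 0 := by
      refine LinearMap.prod_ext ?_ ?_
      · refine LinearMap.ext_on_range hxs fun i => ?_
        simpa using h1 i
      · refine LinearMap.ext_on_range hys fun i => ?_
        simpa using h2 i
    refine funext (Fintype.linearIndependent_iff.mp hf g (Subtype.ext ?_))
    simpa using hl
  have hxy : ∀ g : Fin 3 → ℂ, ∀ i, ∑ r, g r * (f r).1 (x i, 0) =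
      -(μ i * ∑ r, g r * (f r).1 (0, y i)) := by
    intro g i
    rw [Finset.mul_sum, ← Finset.sum_neg_distrib]
    refine Finset.sum_congr rfl fun r _ => ?_
    have := congrFun (hAB i) r
    rw [Pi.smul_apply, hA, hB, smul_eq_mul] at this
    rw [this]
    ring
  have hArank : A.rank = 3 := by
    have : LinearIndependent ℂ A.row := by
      refine Fintype.linearIndependent_iff.mpr fun g hg => ?_
      have h0 : ∀ i, ∑ r, g r * (f r).1 (x i, 0) = 0 := by
        intro i
        have h1 := congrArg (fun v => dotProduct v (x i)) hg
        simp only [sum_dotProduct, smul_dotProduct, zero_dotProduct, smul_eq_mul] at h1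
        simp only [← hA]
        exact h1
      refine congrFun (hindep g ?_ ?_)
      · exact h0
      · intro i
        have := hxy g i
        rw [h0 i] at this
        exact (mul_eq_zero.mp (neg_eq_zero.mp this.symm)).resolve_left (hμ i)
    simpa using this.rank_matrix
  have hBrank : B.rank = 3 := by
    have : LinearIndependent ℂ B.row := by
      refine Fintype.linearIndependent_iff.mpr fun g hg => ?_
      have h0 : ∀ i, ∑ r, g r * (f r).1 (0, y i) = 0 := by
        intro i
        have h1 := congrArg (fun v => dotProduct v (y i)) hg
        simp only [sum_dotProduct, smul_dotProduct, zero_dotProduct, smul_eq_mul] at h1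
        rw [← neg_eq_zero, ← Finset.sum_neg_distrib]
        simp only [← mul_neg, ← hB]
        exact h1
      refine congrFun (hindep g ?_ ?_)
      · intro i
        rw [hxy g i, h0 i, mul_zero, neg_zero]
      · exact h0
    simpa using this.rank_matrix
  have hAa : A.mulVec a = 0 := by ext r; rw [hA, hfV r _ ha]; rfl
  have hBb : B.mulVec b = 0 := by ext r; rw [hB, hfV r _ hb]; exact neg_zero
  choose cx hcx hcx' using hX.exists_rep_eq
  choose cy hcy hcy' using hY.exists_rep_eq
  choose cc hcc hcc' using hc.exists_rep_eq
  refine ⟨⟨A, B, ⟨hArank, ?_⟩, ⟨hBrank, ?_⟩, fun i => ?_, fun i => ?_, 1, fun i => ?_⟩, ?_, ?_⟩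
  · rw [hcc', Matrix.mulVec_smul]; simp [hAa]
  · rw [hcc', Matrix.mulVec_smul]; simp [hBb]
  · rw [hcx', Matrix.mulVec_smul]
    refine smul_ne_zero (hcx i)
      (Matrix.mulVec_ne_zero_of_rank_eq_three hArank hAa (hX i).1 fun p => ?_)
    simpa using hax i i p 0
  · rw [hcy', Matrix.mulVec_smul]
    refine smul_ne_zero (hcy i)
      (Matrix.mulVec_ne_zero_of_rank_eq_three hBrank hBb (hY i).1 fun p => ?_)
    simpa using hby i i p 0
  · refine ⟨cx i * μ i / cy i, div_ne_zero (mul_ne_zero (hcx i) (hμ i)) (hcy i), ?_⟩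
    simp only [hcx', hcy', Matrix.mulVec_smul, hAB, Matrix.SpecialLinearGroup.coe_one,
      Matrix.one_mulVec, smul_smul]
    rw [div_mul_cancel₀ _ (hcy i)]
  · rw [mem_secantLines_iff hX hc]
    rintro ⟨i, j, p, q, h⟩
    exact hax i j p q h
  · rw [mem_secantLines_iff hY hc]
    rintro ⟨i, j, p, q, h⟩
    exact hby i j p q h

/-- A combination that is not congruent, modulo the relations of the points `x`, to a vector
supported on two indices lies on no line through two of the points. -/
theorem sum_smul_ne_add {n : ℕ} {x : Fin n → Fin 4 → ℂ} {κ : Fin n → ℂ}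
    (h : ∀ u : Fin n → ℂ, ∑ i, u i • x i = 0 → ∀ j k, ∃ i, i ≠ j ∧ i ≠ k ∧ κ i ≠ u i)
    (j k : Fin n) (p q : ℂ) : ∑ i, κ i • x i ≠ p • x j + q • x k := by
  intro heq
  obtain ⟨i, hij, hik, hi⟩ := h (κ - Pi.single j p - Pi.single k q) (by
    simp [sub_smul, Finset.sum_sub_distrib, heq, Pi.single_apply, ite_smul]) j k
  simp [hij, hik] at hi

/-- Dual description of camera centers. Suppose that rescaling by `μ` maps `m ≥ n - 5` independent
linear relations of the points `x` to relations of the points `y`. Then every further pair of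
relations `κ` of `x` and `κ'` of `y`, not related by `μ`, gives a pair of centers
`(∑ μᵢ⁻¹ κ'ᵢ xᵢ, ∑ μᵢ κᵢ yᵢ)`. -/
theorem mem_centersLocusOffLines_of_relations {n m : ℕ} {x y : Fin n → Fin 4 → ℂ}
    {X Y : Fin n → P3} (hX : IsCoords x X) (hY : IsCoords y Y)
    (hxs : Submodule.span ℂ (Set.range x) = ⊤) (hys : Submodule.span ℂ (Set.range y) = ⊤)
    {μ κ κ' : Fin n → ℂ} (hμ : ∀ i, μ i ≠ 0) (hκ : ∑ i, κ i • x i = 0) (hκ' : ∑ i, κ' i • y i = 0)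
    {r : Fin m → Fin n → ℂ} (hr : LinearIndependent ℂ r) (hnm : n ≤ 5 + m)
    (hrx : ∀ j, ∑ i, r j i • x i = 0) (hry : ∀ j, ∑ i, (μ i * r j i) • y i = 0)
    (ha : ∀ u : Fin n → ℂ, ∑ i, u i • x i = 0 → ∀ j k, ∃ i, i ≠ j ∧ i ≠ k ∧ κ' i ≠ μ i * u i)
    (hb : ∀ u : Fin n → ℂ, ∑ i, u i • y i = 0 → ∀ j k, ∃ i, i ≠ j ∧ i ≠ k ∧ μ i * κ i ≠ u i)
    {c : MultiProj (Fin 2)}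
    (hc : IsCoords ![∑ i, ((μ i)⁻¹ * κ' i) • x i, ∑ i, (μ i * κ i) • y i] c) :
    c ∈ centersLocusOffLines X Y := by
  let z : Fin n → (Fin 4 → ℂ) × (Fin 4 → ℂ) := fun i => (x i, μ i • y i)
  have hsum : ∀ u : Fin n → ℂ, ∑ i, u i • z i = (∑ i, u i • x i, ∑ i, (μ i * u i) • y i) := by
    intro u
    simp [z, Prod.ext_iff, Prod.fst_sum, Prod.snd_sum, smul_smul, mul_comm]
  have hmem : ∀ u : Fin n → ℂ, ∑ i, u i • z i ∈ Submodule.span ℂ (Set.range z) := fun u =>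
    Submodule.sum_mem _ fun i _ => Submodule.smul_mem _ _ (Submodule.subset_span ⟨i, rfl⟩)
  refine mem_centersLocusOffLines_of_finrank_le hX hY hxs hys hc hμ
    (V := Submodule.span ℂ (Set.range z)) ?_ (fun i => Submodule.subset_span ⟨i, rfl⟩) ?_ ?_
    (sum_smul_ne_add fun u hu j k => ?_) (sum_smul_ne_add hb)
  -- The `m` relations hold among the vectors `z`, so these span a space of dimension `≤ n - m`.
  · have h1 := (Fintype.linearCombination ℂ z).finrank_range_add_finrank_ker
    rw [Fintype.range_linearCombination, Module.finrank_fin_fun] at h1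
    have h2 : m ≤ Module.finrank ℂ (Fintype.linearCombination ℂ z).ker := by
      let r' : Fin m → (Fintype.linearCombination ℂ z).ker := fun j => ⟨r j, by
        rw [LinearMap.mem_ker, Fintype.linearCombination_apply, hsum, hrx, hry]; rfl⟩
      have : LinearIndependent ℂ r' := LinearIndependent.of_comp (Submodule.subtype _) hr
      simpa using this.fintype_card_le_finrank
    omega
  · have := hmem fun i => (μ i)⁻¹ * κ' i
    rw [hsum] at this
    simpa [mul_inv_cancel_left₀ (hμ _), hκ'] using this
  · have := hmem κ
    rwa [hsum, hκ] at this
  · obtain ⟨i, hij, hik, hi⟩ := ha u hu j k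
    refine ⟨i, hij, hik, fun h => hi ?_⟩
    rw [← h, mul_inv_cancel_left₀ (hμ i)]

/-! ### Gale duals of generic points -/

/-- The points `x` span `ℂ⁴` and the columns of `k` span their space of linear relations (so that
the rows of `k` are a Gale dual of `x`). -/
structure IsGale {n m : ℕ} (x : Fin n → Fin 4 → ℂ) (k : Fin n → Fin m → ℂ) : Prop where
  span_eq_top : Submodule.span ℂ (Set.range x) = ⊤
  relation_iff : ∀ u : Fin n → ℂ, ∑ i, u i • x i = 0 ↔ ∃ c : Fin m → ℂ, ∀ i, u i = ∑ j, c j * k i j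

theorem IsGale.sum_eq_zero {n m : ℕ} {x : Fin n → Fin 4 → ℂ} {k : Fin n → Fin m → ℂ}
    (h : IsGale x k) (c : Fin m → ℂ) : ∑ i, (∑ j, c j * k i j) • x i = 0 :=
  (h.relation_iff _).mpr ⟨c, fun _ => rfl⟩

/-- A Gale dual can be chosen as a polynomial function of the points, with a prescribed value at one
tuple of points. By Cramer's rule: write the last points as combinations of the first four. -/
theorem exists_isGale {m : ℕ} (k₀ : Fin (4 + m) → Fin m → ℂ)
    (hk₀ : (Matrix.of fun i j => k₀ (Fin.natAdd 4 i) j).det ≠ 0) :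
    ∃ (k : (Fin (4 + m) × Fin 4 → ℂ) → Fin (4 + m) → Fin m → ℂ) (v₀ : Fin (4 + m) × Fin 4 → ℂ),
      (∀ i j, IsPolyFun fun v => k v i j) ∧ k v₀ = k₀ ∧
        ∀ᶠ v in zariskiNhds v₀, IsGale (fun i j => v (i, j)) (k v) := by
  let B : Matrix (Fin m) (Fin m) ℂ := Matrix.of fun i j => k₀ (Fin.natAdd 4 i) j
  let T : Matrix (Fin 4) (Fin m) ℂ := Matrix.of fun i j => k₀ (Fin.castAdd m i) j
  let P : (Fin (4 + m) × Fin 4 → ℂ) → Matrix (Fin 4) (Fin 4) ℂ := fun v =>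
    Matrix.of fun r i => v (Fin.castAdd m i, r)
  let R : (Fin (4 + m) × Fin 4 → ℂ) → Matrix (Fin 4) (Fin m) ℂ := fun v =>
    Matrix.of fun r i => v (Fin.natAdd 4 i, r)
  let v₀ : Fin (4 + m) × Fin 4 → ℂ := fun p =>
    Fin.addCases (fun i => (1 : Matrix (Fin 4) (Fin 4) ℂ) p.2 i) (fun i => (-(T * B⁻¹)) p.2 i) p.1
  have hB : IsUnit B.det := isUnit_iff_ne_zero.mpr hk₀
  have hP0 : P v₀ = 1 := by ext r i; simp [P, v₀]
  have hR0 : R v₀ = -(T * B⁻¹) := by ext r i; simp [R, v₀]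
  have hPpoly : ∀ r i, IsPolyFun fun v => P v r i := fun r i => by
    simp only [P, Matrix.of_apply]; fun_prop
  refine ⟨fun v i j => Fin.addCases (fun i => (-((P v).adjugate * R v * B)) i j)
    (fun i => ((P v).det • B) i j) i, v₀, fun i j => ?_, ?_, ?_⟩
  · refine Fin.addCases (fun i => ?_) (fun i => ?_) i
    · simp only [Fin.addCases_left, Matrix.neg_apply, Matrix.mul_apply, R, Matrix.of_apply]
      refine IsPolyFun.neg (IsPolyFun.sum fun a => IsPolyFun.mul (IsPolyFun.sum fun b =>
        IsPolyFun.mul (IsPolyFun.adjugate hPpoly i b) (by fun_prop)) (by fun_prop))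
    · simp only [Fin.addCases_right, Matrix.smul_apply, smul_eq_mul]
      exact (IsPolyFun.det hPpoly).mul (.const _)
  · funext i j
    refine Fin.addCases (fun i => ?_) (fun i => ?_) i
    · simp only [Fin.addCases_left, hP0, hR0, Matrix.adjugate_one, Matrix.one_mul, Matrix.neg_mul,
        Matrix.mul_assoc, Matrix.nonsing_inv_mul _ hB, Matrix.mul_one, neg_neg]
      rfl
    · simp [hP0, B]
  · have hdet : ∀ᶠ v in zariskiNhds v₀, (P v).det ≠ 0 :=
      (IsPolyFun.det hPpoly).eventually_ne (by simp [hP0])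
    filter_upwards [hdet] with v hv
    have hPu : IsUnit (P v).det := isUnit_iff_ne_zero.mpr hv
    have hsum : ∀ u : Fin (4 + m) → ℂ, ∑ i, u i • (fun j => v (i, j)) =
        (P v).mulVec (fun i => u (Fin.castAdd m i)) +
          (R v).mulVec (fun i => u (Fin.natAdd 4 i)) := by
      intro u
      ext r
      simp [Fin.sum_univ_add, Matrix.mulVec, dotProduct, P, R, mul_comm]
    constructor
    · rw [eq_top_iff]
      rintro w -
      have h1 := hsum (Fin.addCases ((P v)⁻¹.mulVec w) 0)
      simp only [Fin.addCases_left, Fin.addCases_right] at h1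
      have h2 : (R v).mulVec (fun i : Fin m => (0 : Fin m → ℂ) i) = 0 := Matrix.mulVec_zero _
      rw [h2, Matrix.mulVec_mulVec, Matrix.mul_nonsing_inv _ hPu, Matrix.one_mulVec, add_zero] at h1
      rw [← h1]
      exact Submodule.sum_mem _ fun i _ => Submodule.smul_mem _ _ (Submodule.subset_span ⟨i, rfl⟩)
    · intro u
      rw [hsum]
      set u₁ := fun i => u (Fin.castAdd m i) with hu₁
      set u₂ := fun i => u (Fin.natAdd 4 i) with hu₂
      have hiff : (∃ c : Fin m → ℂ, ∀ i, u i = ∑ j, c j *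
          Fin.addCases (fun i => (-((P v).adjugate * R v * B)) i j)
            (fun i => ((P v).det • B) i j) i) ↔
          ∃ c : Fin m → ℂ, u₁ = (-((P v).adjugate * R v * B)).mulVec c ∧
            u₂ = ((P v).det • B).mulVec c := by
        refine exists_congr fun c => ⟨fun h => ⟨?_, ?_⟩, fun h i => ?_⟩
        · ext i
          simp only [hu₁, h, Fin.addCases_left, Matrix.mulVec, dotProduct, mul_comm]
        · ext i
          simp only [hu₂, h, Fin.addCases_right, Matrix.mulVec, dotProduct, mul_comm]
        · refine Fin.addCases (fun i => ?_) (fun i => ?_) i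
          · simp only [Fin.addCases_left]
            refine (congrFun h.1 i).trans ?_
            simp only [Matrix.mulVec, dotProduct, mul_comm]
          · simp only [Fin.addCases_right]
            refine (congrFun h.2 i).trans ?_
            simp only [Matrix.mulVec, dotProduct, mul_comm]
      rw [hiff]
      constructor
      · intro h
        refine ⟨(P v).det⁻¹ • B⁻¹.mulVec u₂, ?_, ?_⟩
        · have h3 := congrArg (P v).adjugate.mulVec h
          rw [Matrix.mulVec_add, Matrix.mulVec_mulVec, Matrix.adjugate_mul, Matrix.smul_mulVec,
            Matrix.one_mulVec, Matrix.mulVec_zero, Matrix.mulVec_mulVec] at h3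
          rw [Matrix.mulVec_smul, Matrix.neg_mulVec, Matrix.mulVec_mulVec, Matrix.mul_assoc,
            Matrix.mul_nonsing_inv _ hB, Matrix.mul_one, ← eq_neg_of_add_eq_zero_left h3, smul_smul,
            inv_mul_cancel₀ hv, one_smul]
        · rw [Matrix.mulVec_smul, Matrix.smul_mulVec, Matrix.mulVec_mulVec,
            Matrix.mul_nonsing_inv _ hB, Matrix.one_mulVec, smul_smul, inv_mul_cancel₀ hv, one_smul]
      · rintro ⟨c, h1, h2⟩
        rw [h1, h2, Matrix.mulVec_mulVec, Matrix.mulVec_mulVec, Matrix.mul_neg, ← Matrix.mul_assoc,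
          ← Matrix.mul_assoc, Matrix.mul_adjugate, Matrix.smul_mul, Matrix.one_mul, Matrix.mul_smul,
          Matrix.smul_mul, Matrix.neg_mulVec, neg_add_cancel]

/-- To prove that a property holds for generic pairs of tuples of `4 + m` points, it is enough to
prove it when the Gale duals are in a Zariski neighbourhood of some given ones. -/
theorem holdsForGenericPair_of_isGale {m : ℕ} {P : (Fin (4 + m) → P3) → (Fin (4 + m) → P3) → Prop}
    (k₀ k₀' : Fin (4 + m) → Fin m → ℂ)
    (hk₀ : (Matrix.of fun i j => k₀ (Fin.natAdd 4 i) j).det ≠ 0)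
    (hk₀' : (Matrix.of fun i j => k₀' (Fin.natAdd 4 i) j).det ≠ 0)
    (h : ∀ᶠ w in zariskiNhds (Sum.elim (fun p => k₀ p.1 p.2) fun p => k₀' p.1 p.2 :
        (Fin (4 + m) × Fin m) ⊕ (Fin (4 + m) × Fin m) → ℂ),
      ∀ x y X Y, IsCoords x X → IsCoords y Y → IsGale x (fun i j => w (.inl (i, j))) →
        IsGale y (fun i j => w (.inr (i, j))) → P X Y) : HoldsForGenericPair (4 + m) P := by
  obtain ⟨k, v₀, hk, hkv, hG⟩ := exists_isGale k₀ hk₀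
  obtain ⟨k', v₀', hk', hkv', hG'⟩ := exists_isGale k₀' hk₀'
  let v₁ : (Fin (4 + m) ⊕ Fin (4 + m)) × Fin 4 → ℂ := fun p =>
    Sum.elim (fun i => v₀ (i, p.2)) (fun i => v₀' (i, p.2)) p.1
  refine holdsForGenericPair_of_eventually (v₀ := v₁) ?_
  have e1 := (tendsto_zariskiNhds (v₀ := v₁) (w₀ := v₀)
    (φ := fun v p => v (.inl p.1, p.2)) (fun j => by fun_prop) rfl).eventually hG
  have e2 := (tendsto_zariskiNhds (v₀ := v₁) (w₀ := v₀')
    (φ := fun v p => v (.inr p.1, p.2)) (fun j => by fun_prop) rfl).eventually hG'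
  have e3 := (tendsto_zariskiNhds (v₀ := v₁)
    (φ := fun v => Sum.elim (fun p => k (fun q => v (.inl q.1, q.2)) p.1 p.2)
      fun p => k' (fun q => v (.inr q.1, q.2)) p.1 p.2) (by
        rintro (p | p)
        · exact (hk p.1 p.2).comp (σ := (Fin (4 + m) ⊕ Fin (4 + m)) × Fin 4)
            (φ := fun v q => v (.inl q.1, q.2)) fun j => by fun_prop
        · exact (hk' p.1 p.2).comp (σ := (Fin (4 + m) ⊕ Fin (4 + m)) × Fin 4)
            (φ := fun v q => v (.inr q.1, q.2)) fun j => by fun_prop)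
    (by rw [← hkv, ← hkv']; rfl)).eventually h
  filter_upwards [e1, e2, e3] with v h1 h2 h3 X Y hX hY
  exact h3 _ _ X Y hX hY h1 h2

theorem topologicalKrullDim_closure_mono {T : Type*} [TopologicalSpace T] {s t : Set T}
    (h : s ⊆ t) : topologicalKrullDim (closure s) ≤ topologicalKrullDim (closure t) :=
  (Topology.IsEmbedding.inclusion (closure_mono h)).isInducing.topologicalKrullDim_le

theorem centersLocusOffLines_subset {n : ℕ} (X Y : Fin n → P3) :
    centersLocusOffLines X Y ⊆ centersLocus X Y := fun _ h => h.1

/-! ### At most four points -/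

theorem centersLocusOffLines_subset_comp {m n : ℕ} (X Y : Fin n → P3) (f : Fin m → Fin n) :
    centersLocusOffLines X Y ⊆ centersLocusOffLines (X ∘ f) (Y ∘ f) := by
  rintro c ⟨⟨A, B, hA, hB, hAX, hBY, H, hH⟩, hX, hY⟩
  exact ⟨⟨A, B, hA, hB, fun i => hAX _, fun i => hBY _, H, fun i => hH _⟩,
    fun ⟨i, j, h⟩ => hX ⟨f i, f j, h⟩, fun ⟨i, j, h⟩ => hY ⟨f i, f j, h⟩⟩

/-- Pairs of points off the coordinate planes are centers for a pair of projective bases. -/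
theorem mem_centersLocusOffLines_of_bases {x y : Fin 4 → Fin 4 → ℂ} {X Y : Fin 4 → P3}
    (hX : IsCoords x X) (hY : IsCoords y Y) (hx : (Matrix.of x).transpose.det ≠ 0)
    (hy : (Matrix.of y).transpose.det ≠ 0) {α β : Fin 4 → ℂ} (hα : ∀ i, α i ≠ 0)
    (hβ : ∀ i, β i ≠ 0) {c : MultiProj (Fin 2)}
    (hc : IsCoords ![∑ i, α i • x i, ∑ i, β i • y i] c) : c ∈ centersLocusOffLines X Y := by
  have hspan : ∀ z : Fin 4 → Fin 4 → ℂ, (Matrix.of z).transpose.det ≠ 0 →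
      Submodule.span ℂ (Set.range z) = ⊤ := by
    intro z hz
    rw [Matrix.det_transpose] at hz
    have h : LinearIndependent ℂ z := Matrix.linearIndependent_rows_iff_isUnit.mpr
      ((Matrix.isUnit_iff_isUnit_det _).mpr (isUnit_iff_ne_zero.mpr hz))
    exact h.span_eq_top_of_card_eq_finrank' (by simp)
  have hrel : ∀ z : Fin 4 → Fin 4 → ℂ, (Matrix.of z).transpose.det ≠ 0 → ∀ γ : Fin 4 → ℂ,
      (∀ i, γ i ≠ 0) → ∀ u : Fin 4 → ℂ, ∑ i, u i • z i = 0 →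
      ∀ j k, ∃ i, i ≠ j ∧ i ≠ k ∧ γ i ≠ u i := by
    intro z hz γ hγ u hu j k
    have hu0 : u = 0 := by
      refine Matrix.eq_zero_of_mulVec_eq_zero hz ?_
      rw [← hu]
      ext r
      simp [Matrix.mulVec, dotProduct, mul_comm]
    have : ∀ j k : Fin 4, ∃ i, i ≠ j ∧ i ≠ k := by decide
    obtain ⟨i, hj, hk⟩ := this j k
    exact ⟨i, hj, hk, by simpa [hu0] using hγ i⟩
  let z : Fin 4 → (Fin 4 → ℂ) × (Fin 4 → ℂ) := fun i => (x i, (-(β i / α i)) • y i)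
  let V := Submodule.span ℂ (Set.range (Fin.cons (∑ i, α i • x i, 0) z :
    Fin 5 → (Fin 4 → ℂ) × (Fin 4 → ℂ)))
  have ha : (∑ i, α i • x i, 0) ∈ V := Submodule.subset_span ⟨0, rfl⟩
  have hz : ∀ i, z i ∈ V := fun i => Submodule.subset_span ⟨i.succ, rfl⟩
  refine mem_centersLocusOffLines_of_finrank_le hX hY (hspan x hx) (hspan y hy) hc
    (μ := fun i => -(β i / α i)) (fun i => neg_ne_zero.mpr (div_ne_zero (hβ i) (hα i)))
    (V := V) ?_ hz ha ?_ (sum_smul_ne_add (hrel x hx α hα)) (sum_smul_ne_add (hrel y hy β hβ))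
  · exact (finrank_range_le_card _).trans (by simp)
  · have h1 : ∑ i, α i • z i = (∑ i, α i • x i, -∑ i, β i • y i) := by
      rw [Prod.ext_iff, Prod.fst_sum, Prod.snd_sum, ← Finset.sum_neg_distrib]
      refine ⟨rfl, ?_⟩
      change ∑ i, (α i • z i).2 = ∑ i, -(β i • y i)
      refine Finset.sum_congr rfl fun i _ => ?_
      simp only [z, Prod.smul_snd, neg_smul, smul_neg, smul_smul, mul_div_cancel₀ _ (hα i)]
    have h2 := V.sub_mem ha (Submodule.sum_mem V (t := Finset.univ) fun i _ =>
      V.smul_mem (α i) (hz i))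
    rw [h1] at h2
    simpa using h2

/-- For two projective bases, the locus of centers is dense. -/
theorem closure_centersLocusOffLines_of_bases {x y : Fin 4 → Fin 4 → ℂ} {X Y : Fin 4 → P3}
    (hX : IsCoords x X) (hY : IsCoords y Y) (hx : (Matrix.of x).transpose.det ≠ 0)
    (hy : (Matrix.of y).transpose.det ≠ 0) : closure (centersLocusOffLines X Y) = Set.univ := by
  obtain ⟨S, hS, hSZ⟩ := isClosed_multiProj_iff.mp
    (isClosed_closure (s := centersLocusOffLines X Y))
  rw [Set.eq_univ_iff_forall, hSZ]
  intro c F hF v _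
  let α : (Fin 2 × Fin 4 → ℂ) → Fin 4 → ℂ := fun w =>
    (Matrix.of x).transpose⁻¹.mulVec fun j => w (0, j)
  let β : (Fin 2 × Fin 4 → ℂ) → Fin 4 → ℂ := fun w =>
    (Matrix.of y).transpose⁻¹.mulVec fun j => w (1, j)
  have hsum : ∀ z : Fin 4 → Fin 4 → ℂ, (Matrix.of z).transpose.det ≠ 0 → ∀ u : Fin 4 → ℂ,
      ∑ i, (Matrix.of z).transpose⁻¹.mulVec u i • z i = u := by
    intro z hz u
    have := Matrix.mulVec_mulVec u (Matrix.of z).transpose (Matrix.of z).transpose⁻¹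
    rw [Matrix.mul_nonsing_inv _ (isUnit_iff_ne_zero.mpr hz), Matrix.one_mulVec] at this
    conv_rhs => rw [← this]
    ext r
    simp [Matrix.mulVec, dotProduct, mul_comm]
  have hvan : ∀ w : Fin 2 × Fin 4 → ℂ, (∏ i, α w i) * ∏ i, β w i ≠ 0 →
      MvPolynomial.eval w F = 0 := by
    intro w hw
    have hα : ∀ i, α w i ≠ 0 := fun i =>
      Finset.prod_ne_zero_iff.mp (left_ne_zero_of_mul hw) i (Finset.mem_univ i)
    have hβ : ∀ i, β w i ≠ 0 := fun i =>
      Finset.prod_ne_zero_iff.mp (right_ne_zero_of_mul hw) i (Finset.mem_univ i)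
    have hne : ∀ i : Fin 2, ![fun j => w (0, j), fun j => w (1, j)] i ≠ 0 := by
      rw [Fin.forall_fin_two]
      constructor
      · intro h
        refine hα 0 ?_
        change (Matrix.of x).transpose⁻¹.mulVec _ 0 = 0
        rw [show (fun j => w (0, j)) = 0 from h, Matrix.mulVec_zero]
        rfl
      · intro h
        refine hβ 0 ?_
        change (Matrix.of y).transpose⁻¹.mulVec _ 0 = 0
        rw [show (fun j => w (1, j)) = 0 from h, Matrix.mulVec_zero]
        rfl
    have hc := isCoords_mk hne
    have hmem := subset_closure (mem_centersLocusOffLines_of_bases hX hY hx hy hα hβ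
      (c := fun i => Projectivization.mk ℂ _ (hne i)) (by simpa only [α, β, hsum x hx, hsum y hy]))
    rw [hSZ] at hmem
    rw [← hmem F hF _ hc]
    congr 1
    congr 1
    ext ⟨i, j⟩
    fin_cases i <;> rfl
  by_contra hne
  have hα : ∀ i, IsPolyFun fun w => α w i := fun i => by
    simp only [α, Matrix.mulVec, dotProduct]; fun_prop
  have hβ : ∀ i, IsPolyFun fun w => β w i := fun i => by
    simp only [β, Matrix.mulVec, dotProduct]; fun_prop
  have hone : ∃ w, (∏ i, α w i) * ∏ i, β w i ≠ 0 := by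
    refine ⟨fun p => ![∑ i, x i, ∑ i, y i] p.1 p.2, ?_⟩
    have h1 : ∀ z : Fin 4 → Fin 4 → ℂ, (Matrix.of z).transpose.det ≠ 0 →
        (Matrix.of z).transpose⁻¹.mulVec (∑ i, z i) = 1 := by
      intro z hz
      have : ∑ i, z i = (Matrix.of z).transpose.mulVec 1 := by
        ext r
        simp [Matrix.mulVec, dotProduct]
      rw [this, Matrix.mulVec_mulVec, Matrix.nonsing_inv_mul _ (isUnit_iff_ne_zero.mpr hz),
        Matrix.one_mulVec]
    have h2 : ∀ i, α (fun p => ![∑ i, x i, ∑ i, y i] p.1 p.2) i = 1 :=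
      fun i => congrFun (h1 x hx) i
    have h3 : ∀ i, β (fun p => ![∑ i, x i, ∑ i, y i] p.1 p.2) i = 1 :=
      fun i => congrFun (h1 y hy) i
    simp only [h2, h3, Finset.prod_const_one, mul_one]
    exact one_ne_zero
  obtain ⟨w, hw⟩ := IsPolyFun.exists_mul_ne_zero (f := fun w => MvPolynomial.eval w F)
    (g := fun w => (∏ i, α w i) * ∏ i, β w i) ⟨F, fun _ => rfl⟩ (by fun_prop) ⟨_, hne⟩ hone
  exact left_ne_zero_of_mul hw (hvan w (right_ne_zero_of_mul hw))

/-- For at most four points every pair of general points is a pair of centers. -/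
theorem holdsForGenericPair_centersVariety_eq_univ {n : ℕ} (hn : n ≤ 4) :
    HoldsForGenericPair n fun X Y =>
      centersVariety X Y = Set.univ ∧ centersVarietyOffLines X Y = Set.univ := by
  -- Complete the tuples to four points by points of the standard basis.
  let pad : (Fin n → Fin 4 → ℂ) → Fin 4 → Fin 4 → ℂ := fun x i =>
    if h : (i : ℕ) < n then x ⟨i, h⟩ else Pi.single i 1
  let v₀ : (Fin n ⊕ Fin n) × Fin 4 → ℂ := fun p =>
    Pi.single (M := fun _ => ℂ) (Fin.castLE hn (p.1.elim id id)) 1 p.2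
  have hpoly : ∀ s : Fin n → Fin n ⊕ Fin n,
      IsPolyFun fun v : (Fin n ⊕ Fin n) × Fin 4 → ℂ =>
        (Matrix.of (pad fun i j => v (s i, j))).transpose.det := by
    intro s
    refine IsPolyFun.det fun i j => ?_
    by_cases h : (j : ℕ) < n
    · simp only [pad, Matrix.transpose_apply, Matrix.of_apply, h, dif_pos]; fun_prop
    · simp only [pad, Matrix.transpose_apply, Matrix.of_apply, h, dif_neg, not_false_eq_true]
      fun_prop
  have hv₀ : ∀ s : Fin n → Fin n ⊕ Fin n, (∀ i, (s i).elim id id = i) →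
      (Matrix.of (pad fun i j => v₀ (s i, j))).transpose.det ≠ 0 := by
    intro s hs
    have : Matrix.of (pad fun i j => v₀ (s i, j)) = 1 := by
      ext i j
      by_cases h : (i : ℕ) < n
      · simp only [Matrix.of_apply, pad, h, dif_pos, v₀, hs, Matrix.one_apply, Pi.single_apply]
        simp [Fin.ext_iff, eq_comm]
      · simp [pad, h, Matrix.one_apply, Pi.single_apply, eq_comm]
    simp [this]
  refine holdsForGenericPair_of_eventually (v₀ := v₀) ?_
  filter_upwards [(hpoly Sum.inl).eventually_ne (hv₀ _ fun _ => rfl),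
    (hpoly Sum.inr).eventually_ne (hv₀ _ fun _ => rfl)] with v hx hy X Y hX hY
  have hpad : ∀ (x : Fin n → Fin 4 → ℂ) (X : Fin n → P3), IsCoords x X →
      ∃ X', IsCoords (pad x) X' ∧ X' ∘ Fin.castLE hn = X := by
    intro x X hX
    have h : ∀ i, pad x i ≠ 0 := by
      intro i
      by_cases h : (i : ℕ) < n
      · simpa only [pad, h, dif_pos] using (hX ⟨i, h⟩).1
      · simp [pad, h]
    refine ⟨_, isCoords_mk h, funext fun i => ?_⟩
    obtain ⟨h1, h2⟩ := hX i
    simp only [Function.comp_apply, ← h2]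
    congr 1
    simp [pad]
  obtain ⟨X', hX', rfl⟩ := hpad _ X hX
  obtain ⟨Y', hY', rfl⟩ := hpad _ Y hY
  have h1 := closure_centersLocusOffLines_of_bases hX' hY' hx hy
  have h2 : closure (centersLocusOffLines (X' ∘ Fin.castLE hn) (Y' ∘ Fin.castLE hn)) = Set.univ :=
    Set.univ_subset_iff.mp (h1 ▸ closure_mono (centersLocusOffLines_subset_comp X' Y' _))
  exact ⟨Set.univ_subset_iff.mp (h2 ▸ closure_mono (centersLocusOffLines_subset _ _)), h2⟩

/-! ### Five points -/

/-- A linear form with prescribed values at the points exists if the values satisfy the linear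
relations of the points. -/
theorem exists_dual_apply_eq {n : ℕ} {x : Fin n → Fin 4 → ℂ} {d : Fin n → ℂ}
    (h : ∀ u : Fin n → ℂ, ∑ i, u i • x i = 0 → ∑ i, u i * d i = 0) :
    ∃ ℓ : Module.Dual ℂ (Fin 4 → ℂ), ∀ i, ℓ (x i) = d i := by
  have hd : Fintype.linearCombination ℂ d ∈ (Fintype.linearCombination ℂ x).dualMap.range := by
    rw [LinearMap.range_dualMap_eq_dualAnnihilator_ker, Submodule.mem_dualAnnihilator]
    intro u hu
    rw [LinearMap.mem_ker, Fintype.linearCombination_apply] at hu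
    simpa [Fintype.linearCombination_apply] using h u hu
  obtain ⟨ℓ, hℓ⟩ := hd
  refine ⟨ℓ, fun i => ?_⟩
  have := LinearMap.congr_fun hℓ (Pi.single i 1)
  simpa using this

section FivePoints

variable {x y : Fin 5 → Fin 4 → ℂ} {k k' : Fin 5 → Fin 1 → ℂ}

/-- For five points with the single relation `k`, the vector `α k` with distinct `αᵢ` is not
a relation, even after changing two entries. -/
theorem IsGale.exists_ne_of_injective (hx : IsGale x k) (hk : ∀ i, k i 0 ≠ 0) {α : Fin 5 → ℂ}
    (hα : Function.Injective α) (u : Fin 5 → ℂ) (hu : ∑ i, u i • x i = 0) (j l : Fin 5) :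
    ∃ i, i ≠ j ∧ i ≠ l ∧ α i * k i 0 ≠ u i := by
  obtain ⟨c, hc⟩ := (hx.relation_iff u).mp hu
  have : ∀ j l : Fin 5, ∃ i i', i ≠ i' ∧ i ≠ j ∧ i ≠ l ∧ i' ≠ j ∧ i' ≠ l := by decide
  obtain ⟨i, i', hne, h1, h2, h3, h4⟩ := this j l
  by_contra! hcon
  have e1 := hcon i h1 h2
  have e2 := hcon i' h3 h4
  rw [hc, Fin.sum_univ_one] at e1 e2
  exact hne (hα ((mul_right_cancel₀ (hk i) e1).trans (mul_right_cancel₀ (hk i') e2).symm))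

/-- For five points the rescaling is arbitrary; `α` is its inverse, up to the ratio of the relations
of `x` and `y`. -/
theorem mem_centersLocusOffLines_of_five {X Y : Fin 5 → P3} (hX : IsCoords x X) (hY : IsCoords y Y)
    (hx : IsGale x k) (hy : IsGale y k') (hk : ∀ i, k i 0 ≠ 0) (hk' : ∀ i, k' i 0 ≠ 0)
    {α : Fin 5 → ℂ} (hα : Function.Injective α) (hα0 : ∀ i, α i ≠ 0) {c : MultiProj (Fin 2)}
    (hc : IsCoords ![∑ i, (α i * k i 0) • x i, ∑ i, ((α i)⁻¹ * k' i 0) • y i] c) :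
    c ∈ centersLocusOffLines X Y := by
  have hμ : ∀ i, k' i 0 / (α i * k i 0) ≠ 0 := fun i =>
    div_ne_zero (hk' i) (mul_ne_zero (hα0 i) (hk i))
  have e1 : ∀ i, (k' i 0 / (α i * k i 0))⁻¹ * k' i 0 = α i * k i 0 := fun i => by
    have := hk' i
    field_simp
  have e2 : ∀ i, k' i 0 / (α i * k i 0) * k i 0 = (α i)⁻¹ * k' i 0 := fun i => by
    have h1 := hk i
    have h2 := hα0 i
    field_simp
  refine mem_centersLocusOffLines_of_relations hX hY hx.span_eq_top hy.span_eq_top hμ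
    (κ := fun i => k i 0) (κ' := fun i => k' i 0) ?_ ?_ (r := Fin.elim0)
    (linearIndependent_empty_type) (m := 0) le_rfl (fun j => j.elim0) (fun j => j.elim0) ?_ ?_ ?_
  · simpa using hx.sum_eq_zero 1
  · simpa using hy.sum_eq_zero 1
  · intro u hu j l
    obtain ⟨i, h1, h2, h3⟩ := hx.exists_ne_of_injective hk hα u hu j l
    refine ⟨i, h1, h2, fun h => h3 ?_⟩
    exact (e1 i).symm.trans ((congrArg (_ * ·) h).trans (inv_mul_cancel_left₀ (hμ i) _))
  · intro u hu j l
    obtain ⟨i, h1, h2, h3⟩ := hy.exists_ne_of_injective hk' (α := fun i => (α i)⁻¹)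
      (fun a b h => hα (inv_injective h)) u hu j l
    exact ⟨i, h1, h2, by rwa [e2]⟩
  · simpa only [e1, e2] using hc

/-- Since `∑ kᵢ xᵢ = 0` is the only relation, the linear forms in `∑ αᵢ kᵢ xᵢ` are the linear forms
`∑ αᵢ dᵢ` that vanish for constant `α`. -/
theorem IsGale.exists_dual_five (hx : IsGale x k) (hk : ∀ i, k i 0 ≠ 0) {d : Fin 5 → ℂ}
    (hd : ∑ i, d i = 0) :
    ∃ ℓ : Module.Dual ℂ (Fin 4 → ℂ), ∀ α : Fin 5 → ℂ,
      ℓ (∑ i, (α i * k i 0) • x i) = ∑ i, α i * d i := by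
  obtain ⟨ℓ, hℓ⟩ := exists_dual_apply_eq (x := x) (d := fun i => (k i 0)⁻¹ * d i) (by
    intro u hu
    obtain ⟨c, hc⟩ := (hx.relation_iff u).mp hu
    simp only [hc, Fin.sum_univ_one, mul_assoc, mul_inv_cancel_left₀ (hk _)]
    rw [← Finset.mul_sum, hd, mul_zero])
  refine ⟨ℓ, fun α => ?_⟩
  simp only [map_sum, map_smul, hℓ, smul_eq_mul, mul_assoc, mul_inv_cancel_left₀ (hk _)]

/-- Coordinates on the pairs of centers for five points. Moving the zeroth coordinate moves the
second center only; moving each of the others moves the first center in a further direction. -/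
def fiveParam (s : Fin 4 → ℂ) : Fin 5 → ℂ := ![s 3 + s 0, s 2 + s 0, s 1 + s 0, 1 + s 0, s 0]

theorem isPolyFun_fiveParam (i : Fin 5) : IsPolyFun fun s => fiveParam s i := by
  fin_cases i <;> simp [fiveParam] <;> fun_prop

/-- For five points the rescalings, up to a common factor, give a four-dimensional family of pairs
of centers. -/
theorem le_topologicalKrullDim_of_five {X Y : Fin 5 → P3} (hX : IsCoords x X) (hY : IsCoords y Y)
    (hx : IsGale x k) (hy : IsGale y k') (hk : ∀ i, k i 0 ≠ 0) (hk' : ∀ i, k' i 0 ≠ 0) :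
    ((4 : ℕ) : WithBot ℕ∞) ≤ topologicalKrullDim (closure (centersLocusOffLines X Y)) := by
  let γ : (Fin 4 → ℂ) → Fin 5 → ℂ := fun s i => ∏ j ∈ Finset.univ.erase i, fiveParam s j
  let Φ : (Fin 4 → ℂ) → Fin 2 → Fin 4 → ℂ := fun s =>
    ![∑ i, (fiveParam s i * k i 0) • x i, ∑ i, (γ s i * k' i 0) • y i]
  let D : (Fin 4 → ℂ) → ℂ := fun s =>
    (Matrix.vandermonde (fiveParam s)).det * ∏ i, fiveParam s i
  have hα := isPolyFun_fiveParam
  have hγ : ∀ i, IsPolyFun fun s => γ s i := fun i => by simp only [γ]; fun_prop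
  have hD : IsPolyFun D :=
    (IsPolyFun.det fun i j => by simp only [Matrix.vandermonde_apply]; fun_prop).mul (by fun_prop)
  have hDiff : ∀ s, D s ≠ 0 ↔ Function.Injective (fiveParam s) ∧ ∀ i, fiveParam s i ≠ 0 := by
    intro s
    simp only [D, mul_ne_zero_iff, Matrix.det_vandermonde_ne_zero_iff, Finset.prod_ne_zero_iff,
      Finset.mem_univ, forall_const]
  have hγinv : ∀ s, D s ≠ 0 → γ s = fun i => (∏ j, fiveParam s j) * (fiveParam s i)⁻¹ := by
    intro s hs
    ext i
    rw [← Finset.mul_prod_erase _ _ (Finset.mem_univ i), mul_comm, ← mul_assoc,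
      inv_mul_cancel₀ (((hDiff s).mp hs).2 i), one_mul]
  have hprod : ∀ s, D s ≠ 0 → ∏ j, fiveParam s j ≠ 0 := fun s hs => right_ne_zero_of_mul hs
  have hγinj : ∀ s, D s ≠ 0 → Function.Injective (γ s) := by
    intro s hs a b hab
    rw [hγinv s hs] at hab
    exact ((hDiff s).mp hs).1 (inv_injective (mul_left_cancel₀ (hprod s hs) hab))
  have hwit : ∀ s, fiveParam s 0 ≠ 0 ∧ fiveParam s 1 ≠ 0 ∧ fiveParam s 2 ≠ 0 ∧ fiveParam s 3 ≠ 0 ∧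
      fiveParam s 4 ≠ 0 → (fiveParam s 0 ≠ fiveParam s 1 ∧ fiveParam s 0 ≠ fiveParam s 2 ∧
      fiveParam s 0 ≠ fiveParam s 3 ∧ fiveParam s 0 ≠ fiveParam s 4) →
      (fiveParam s 1 ≠ fiveParam s 2 ∧ fiveParam s 1 ≠ fiveParam s 3 ∧
      fiveParam s 1 ≠ fiveParam s 4) → (fiveParam s 2 ≠ fiveParam s 3 ∧
      fiveParam s 2 ≠ fiveParam s 4 ∧ fiveParam s 3 ≠ fiveParam s 4) → D s ≠ 0 := by
    rintro s ⟨a0, a1, a2, a3, a4⟩ ⟨h1, h2, h3, h4⟩ ⟨h5, h6, h7⟩ ⟨h8, h9, h10⟩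
    rw [hDiff]
    constructor
    · intro a b hab
      fin_cases a <;> fin_cases b <;>
        first
        | rfl
        | exact absurd hab (by assumption)
        | exact absurd hab.symm (by assumption)
    · intro i
      fin_cases i <;> assumption
  have hs₀ : D ![1, 2, 3, 4] ≠ 0 := by apply hwit <;> (simp [fiveParam]; try norm_num)
  have hs₁ : D ![2, 2, 3, 4] ≠ 0 := by apply hwit <;> (simp [fiveParam]; try norm_num)
  refine le_topologicalKrullDim_of_param (Φ := Φ) (D := D) ?_ hD ![1, 2, 3, 4] ?_ ?_ ?_ ?_
  · intro i j
    fin_cases i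
    · simp only [Φ, Fin.zero_eta, Matrix.cons_val_zero, Finset.sum_apply, Pi.smul_apply,
        smul_eq_mul]
      fun_prop
    · simp only [Φ, Fin.mk_one, Matrix.cons_val_one, Matrix.cons_val_zero, Finset.sum_apply,
        Pi.smul_apply, smul_eq_mul]
      fun_prop
  · exact hs₀
  · intro s hs
    rw [Fin.forall_fin_two]
    constructor
    · have := sum_smul_ne_add (hx.exists_ne_of_injective hk ((hDiff s).mp hs).1) 0 0 0 0
      rwa [zero_smul, add_zero] at this
    · have := sum_smul_ne_add (hy.exists_ne_of_injective hk' (hγinj s hs)) 0 0 0 0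
      rwa [zero_smul, add_zero] at this
  · intro s hs c hc
    refine mem_centersLocusOffLines_of_five hX hY hx hy hk hk' ((hDiff s).mp hs).1
      ((hDiff s).mp hs).2 ?_
    have := hc.smul (c := ![1, (∏ j, fiveParam s j)⁻¹])
      (Fin.forall_fin_two.mpr ⟨one_ne_zero, inv_ne_zero (hprod s hs)⟩)
    convert this using 1
    ext i j
    fin_cases i
    · simp [Φ]
    · simp only [Φ, hγinv s hs, Fin.mk_one, Matrix.cons_val_one, Matrix.cons_val_zero,
        Finset.smul_sum, smul_smul]
      simp only [← mul_assoc, inv_mul_cancel₀ (hprod s hs), one_mul]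
  · -- For `l = 0` the witness is a linear form in the second center that vanishes at the base
    -- point.
    -- For `l > 0` it is a form in the first center; it vanishes at the base point, and
    -- moving the earlier parameters does not change it: its coefficients sum to zero, and those
    -- of the entries of `fiveParam` that contain `s 1`, …, `s (l - 1)` are zero.
    have first : ∀ d : Fin 5 → ℂ, ∑ i, d i = 0 → ∀ t : Fin 4 → ℂ, D t ≠ 0 → ∀ l : Fin 4,
        (∀ s : Fin 4 → ℂ, (∀ j, l ≤ j → s j = ![1, 2, 3, 4] j) → ∑ i, fiveParam s i * d i = 0) →
        (∀ j, l < j → t j = ![1, 2, 3, 4] j) → ∑ i, fiveParam t i * d i ≠ 0 →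
        ∃ (i : Fin 2) (U : Submodule ℂ (Fin 4 → ℂ)),
          (∀ s, D s ≠ 0 → (∀ j, l ≤ j → s j = ![1, 2, 3, 4] j) → Φ s i ∈ U) ∧
          ∃ s, D s ≠ 0 ∧ (∀ j, l < j → s j = ![1, 2, 3, 4] j) ∧ Φ s i ∉ U := by
      intro d hd t ht l h0 hlt h1
      obtain ⟨ℓ, hℓ⟩ := hx.exists_dual_five hk hd
      exact ⟨0, ℓ.ker, fun s _ hs => (hℓ _).trans (h0 s hs), t, ht, hlt,
        fun h => h1 ((hℓ _).symm.trans h)⟩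
    intro l
    fin_cases l
    · obtain ⟨ℓ, hℓ⟩ := hy.exists_dual_five hk' (d := ![0, 0, 3, -4, 1])
        (by simp [Fin.sum_univ_five]; norm_num)
      refine ⟨1, ℓ.ker, fun s _ hs => (hℓ _).trans ?_, ![2, 2, 3, 4], ?_, ?_,
        fun h => absurd ((hℓ _).symm.trans h) ?_⟩
      · have : s = ![1, 2, 3, 4] := funext fun j => hs j (Fin.zero_le j)
        subst this
        rw [hγinv _ hs₀]
        simp [fiveParam, Fin.sum_univ_five, Fin.prod_univ_five]
        norm_num
      · exact hs₁
      · intro j hj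
        fin_cases j <;> simp at hj ⊢
      · rw [hγinv _ hs₁]
        simp [fiveParam, Fin.sum_univ_five, Fin.prod_univ_five]
        norm_num
    · refine first ![0, 0, 1, -2, 1] ?_ ![1, 10, 3, 4] ?_ _ ?_ ?_ ?_
      · simp [Fin.sum_univ_five]; norm_num
      · apply hwit <;> (simp [fiveParam]; try norm_num)
      · intro s hs
        have h1 := hs 1
        have h2 := hs 2
        have h3 := hs 3
        simp at h1 h2 h3
        simp [fiveParam, Fin.sum_univ_five, *]
        ring
      · intro j hj
        fin_cases j <;> simp at hj ⊢
      · simp [fiveParam, Fin.sum_univ_five]; norm_num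
    · refine first ![0, 1, 0, -3, 2] ?_ ![1, 2, 10, 4] ?_ _ ?_ ?_ ?_
      · simp [Fin.sum_univ_five]; norm_num
      · apply hwit <;> (simp [fiveParam]; try norm_num)
      · intro s hs
        have h1 := hs 1
        have h2 := hs 2
        have h3 := hs 3
        simp at h1 h2 h3
        simp [fiveParam, Fin.sum_univ_five, *]
        ring
      · intro j hj
        fin_cases j <;> simp at hj ⊢
      · simp [fiveParam, Fin.sum_univ_five]; norm_num
    · refine first ![1, 0, 0, -4, 3] ?_ ![1, 2, 3, 10] ?_ _ ?_ ?_ ?_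
      · simp [Fin.sum_univ_five]; norm_num
      · apply hwit <;> (simp [fiveParam]; try norm_num)
      · intro s hs
        have h1 := hs 1
        have h2 := hs 2
        have h3 := hs 3
        simp at h1 h2 h3
        simp [fiveParam, Fin.sum_univ_five, *]
        ring
      · intro j hj
        fin_cases j <;> simp at hj ⊢
      · simp [fiveParam, Fin.sum_univ_five]; norm_num

end FivePoints

/-! ### Six points -/

/-- Any four of the vectors `ρ i` of `ℂ⁴` are linearly independent. -/
def FourIndependent {n : ℕ} (ρ : Fin n → Fin 4 → ℂ) : Prop :=
  ∀ e : Fin 4 ↪ Fin n, (Matrix.of fun r => ρ (e r)).det ≠ 0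

/-- A linear form that vanishes at all but two of at least six such vectors is zero. -/
theorem FourIndependent.eq_zero {n : ℕ} (hn : 6 ≤ n) {ρ : Fin n → Fin 4 → ℂ}
    (hρ : FourIndependent ρ) (c : Fin 4 → ℂ) (j l : Fin n)
    (h : ∀ i, i ≠ j → i ≠ l → ∑ r, ρ i r * c r = 0) : c = 0 := by
  obtain ⟨e⟩ : Nonempty (Fin 4 ↪ {i : Fin n // i ∉ ({j, l} : Finset (Fin n))}) := by
    refine Function.Embedding.nonempty_of_card_le ?_
    rw [Fintype.card_subtype_compl, Fintype.card_fin, Fintype.card_coe]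
    have := Finset.card_le_two (a := j) (b := l)
    simp only [Fintype.card_fin]
    omega
  refine Matrix.eq_zero_of_mulVec_eq_zero (hρ (e.trans (Function.Embedding.subtype _))) ?_
  ext r
  have he := (e r).2
  simp only [Finset.mem_insert, Finset.mem_singleton, not_or] at he
  simpa [Matrix.mulVec, dotProduct] using h (e r).1 he.1 he.2

theorem eventually_fourIndependent {σ : Type} {n : ℕ} {ρ : (σ → ℂ) → Fin n → Fin 4 → ℂ}
    (hρ : ∀ i r, IsPolyFun fun v => ρ v i r) {v₀ : σ → ℂ} (h : FourIndependent (ρ v₀)) :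
    ∀ᶠ v in zariskiNhds v₀, FourIndependent (ρ v) :=
  Filter.eventually_all.mpr fun e =>
    IsPolyFun.eventually_ne (IsPolyFun.det fun r j => hρ (e r) j) (h e)

section SixPoints

variable {x y : Fin 6 → Fin 4 → ℂ} {k k' : Fin 6 → Fin 2 → ℂ}

/-- The products of relations of `x` with relations of `y`. -/
def sixProducts (k k' : Fin 6 → Fin 2 → ℂ) (i : Fin 6) : Fin 4 → ℂ :=
  ![k i 0 * k' i 0, k i 1 * k' i 0, k i 0 * k' i 1, k i 1 * k' i 1]

/-- The products of relations of `x` with products of two relations of `y`. -/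
def sixTripleProducts (k k' : Fin 6 → Fin 2 → ℂ) (i : Fin 6) : Fin 6 → ℂ :=
  ![k i 0 * k' i 0 ^ 2, k i 1 * k' i 0 ^ 2, k i 0 * (k' i 0 * k' i 1), k i 1 * (k' i 0 * k' i 1),
    k i 0 * k' i 1 ^ 2, k i 1 * k' i 1 ^ 2]

/-- For six points and relations `k₁ + s k₀` of `x`, `k'₁ + t k'₀` of `y`, the vector of
coefficients of the first center avoids the relations of `x`, even after changing two entries. -/
theorem IsGale.exists_ne_six (hx : IsGale x k) (h4 : FourIndependent (sixProducts k k')) {s t : ℂ}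
    (hs : ∀ i, k i 1 + s * k i 0 ≠ 0) (u : Fin 6 → ℂ) (hu : ∑ i, u i • x i = 0) (j l : Fin 6) :
    ∃ i, i ≠ j ∧ i ≠ l ∧
      k' i 0 ≠ (k' i 1 + t * k' i 0) / (k i 1 + s * k i 0) * u i := by
  obtain ⟨c, hc⟩ := (hx.relation_iff u).mp hu
  by_contra! hcon
  have := h4.eq_zero le_rfl ![s - t * c 0, 1 - t * c 1, -c 0, -c 1] j l (by
    intro i hj hl
    have h := hcon i hj hl
    rw [hc, Fin.sum_univ_two, div_mul_eq_mul_div, eq_div_iff (hs i)] at h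
    simp only [sixProducts, Fin.sum_univ_four, Matrix.cons_val]
    linear_combination h)
  have h1 := congrFun this 1
  have h3 := congrFun this 3
  simp only [Matrix.cons_val, Pi.zero_apply, neg_eq_zero] at h1 h3
  simp [h3] at h1

/-- The counterpart of `IsGale.exists_ne_six` for the second center. -/
theorem IsGale.exists_ne_six' (hy : IsGale y k') (h4 : FourIndependent (sixProducts k k')) {s t : ℂ}
    (hs : ∀ i, k i 1 + s * k i 0 ≠ 0) (u : Fin 6 → ℂ) (hu : ∑ i, u i • y i = 0) (j l : Fin 6) :
    ∃ i, i ≠ j ∧ i ≠ l ∧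
      (k' i 1 + t * k' i 0) / (k i 1 + s * k i 0) * k i 0 ≠ u i := by
  obtain ⟨c, hc⟩ := (hy.relation_iff u).mp hu
  by_contra! hcon
  have := h4.eq_zero le_rfl ![t - s * c 0, -c 0, 1 - s * c 1, -c 1] j l (by
    intro i hj hl
    have h := hcon i hj hl
    rw [hc, Fin.sum_univ_two, div_mul_eq_mul_div, div_eq_iff (hs i)] at h
    simp only [sixProducts, Fin.sum_univ_four, Matrix.cons_val]
    linear_combination h)
  have h2 := congrFun this 2
  have h3 := congrFun this 3
  simp only [Matrix.cons_val, Pi.zero_apply, neg_eq_zero] at h2 h3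
  simp [h3] at h2

/-- For six points, the parameters `s` are those of a relation `k₁ + s₀ k₀` of `x` and a relation
`k'₁ + s₁ k'₀` of `y`, and the rescaling is the quotient of the two. While `s₁ = 0`, the first
center moves on a line; it leaves that line when `s₁` moves. -/
theorem le_topologicalKrullDim_of_six {X Y : Fin 6 → P3} (hX : IsCoords x X) (hY : IsCoords y Y)
    (hx : IsGale x k) (hy : IsGale y k') (h4 : FourIndependent (sixProducts k k'))
    (h6 : (Matrix.of (sixTripleProducts k k')).det ≠ 0) (hk : ∀ i, k i 1 ≠ 0)
    (hk' : ∀ i, k' i 1 ≠ 0) (hk1 : ∀ i, k i 1 + k i 0 ≠ 0) (hk1' : ∀ i, k' i 1 + k' i 0 ≠ 0) :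
    ((2 : ℕ) : WithBot ℕ∞) ≤ topologicalKrullDim (closure (centersLocusOffLines X Y)) := by
  let p : (Fin 2 → ℂ) → Fin 6 → ℂ := fun s i => k i 1 + s 0 * k i 0
  let q : (Fin 2 → ℂ) → Fin 6 → ℂ := fun s i => k' i 1 + s 1 * k' i 0
  -- The two centers, cleared of the denominators `q s i` and `p s i`.
  let Φ : (Fin 2 → ℂ) → Fin 2 → Fin 4 → ℂ := fun s =>
    ![∑ i, ((∏ j ∈ Finset.univ.erase i, q s j) * (p s i * k' i 0)) • x i,
      ∑ i, ((∏ j ∈ Finset.univ.erase i, p s j) * (q s i * k i 0)) • y i]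
  let D : (Fin 2 → ℂ) → ℂ := fun s => (∏ i, p s i) * ∏ i, q s i
  have hp : ∀ s, D s ≠ 0 → ∀ i, p s i ≠ 0 := fun s hs i =>
    Finset.prod_ne_zero_iff.mp (left_ne_zero_of_mul hs) i (Finset.mem_univ i)
  have hq : ∀ s, D s ≠ 0 → ∀ i, q s i ≠ 0 := fun s hs i =>
    Finset.prod_ne_zero_iff.mp (right_ne_zero_of_mul hs) i (Finset.mem_univ i)
  have herase : ∀ f : Fin 6 → ℂ, (∀ i, f i ≠ 0) → ∀ i,
      ∏ j ∈ Finset.univ.erase i, f j = (∏ j, f j) * (f i)⁻¹ := by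
    intro f hf i
    rw [← Finset.mul_prod_erase _ _ (Finset.mem_univ i), mul_comm, ← mul_assoc,
      inv_mul_cancel₀ (hf i), one_mul]
  have hΦa : ∀ s, D s ≠ 0 →
      Φ s 0 = (∏ j, q s j) • ∑ i, ((q s i / p s i)⁻¹ * k' i 0) • x i := by
    intro s hs
    simp only [Φ, Matrix.cons_val_zero, Finset.smul_sum, smul_smul, herase _ (hq s hs), inv_div]
    refine Finset.sum_congr rfl fun i _ => ?_
    congr 1
    ring
  have hΦb : ∀ s, D s ≠ 0 → Φ s 1 = (∏ j, p s j) • ∑ i, (q s i / p s i * k i 0) • y i := by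
    intro s hs
    simp only [Φ, Matrix.cons_val_one, Matrix.cons_val_zero, Finset.smul_sum, smul_smul,
      herase _ (hp s hs)]
    refine Finset.sum_congr rfl fun i _ => ?_
    congr 1
    ring
  have ha : ∀ s, D s ≠ 0 → ∀ u : Fin 6 → ℂ, ∑ i, u i • x i = 0 → ∀ j l, ∃ i, i ≠ j ∧ i ≠ l ∧
      k' i 0 ≠ q s i / p s i * u i := fun s hs => hx.exists_ne_six h4 (hp s hs)
  have hb : ∀ s, D s ≠ 0 → ∀ u : Fin 6 → ℂ, ∑ i, u i • y i = 0 → ∀ j l, ∃ i, i ≠ j ∧ i ≠ l ∧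
      q s i / p s i * k i 0 ≠ u i := fun s hs => hy.exists_ne_six' h4 (hp s hs)
  have hD0 : D 0 ≠ 0 := by simp [D, p, q, Finset.prod_ne_zero_iff, hk, hk']
  have hD1 : D ![1, 0] ≠ 0 := by simp [D, p, q, Finset.prod_ne_zero_iff, hk1, hk']
  have hD2 : D ![0, 1] ≠ 0 := by simp [D, p, q, Finset.prod_ne_zero_iff, hk, hk1']
  -- The first center moves on the line through `a` and `g` as long as `s 1 = 0`.
  let a : Fin 4 → ℂ := ∑ i, ((k' i 1)⁻¹ * (k i 1 * k' i 0)) • x i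
  let g : Fin 4 → ℂ := ∑ i, ((k' i 1)⁻¹ * (k i 0 * k' i 0)) • x i
  have hline : ∀ s, D s ≠ 0 → s 1 = 0 → Φ s 0 = (∏ j, k' j 1) • (a + s 0 • g) := by
    intro s hs hs1
    rw [hΦa s hs]
    simp only [q, hs1, zero_mul, add_zero, a, g, Finset.smul_sum, ← Finset.sum_add_distrib,
      smul_smul, ← add_smul, p, inv_div]
    refine Finset.sum_congr rfl fun i _ => ?_
    congr 1
    ring
  refine le_topologicalKrullDim_of_param (Φ := Φ) (D := D) ?_ (by simp only [D, p, q]; fun_prop) 0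
    hD0 ?_ ?_ ?_
  · intro i j
    fin_cases i
    · simp only [Φ, p, q, Fin.zero_eta, Matrix.cons_val_zero, Finset.sum_apply, Pi.smul_apply,
        smul_eq_mul]
      fun_prop
    · simp only [Φ, p, q, Fin.mk_one, Matrix.cons_val_one, Matrix.cons_val_zero, Finset.sum_apply,
        Pi.smul_apply, smul_eq_mul]
      fun_prop
  · intro s hs
    rw [Fin.forall_fin_two, hΦa s hs, hΦb s hs]
    refine ⟨smul_ne_zero (right_ne_zero_of_mul hs) ?_, smul_ne_zero (left_ne_zero_of_mul hs) ?_⟩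
    · have := sum_smul_ne_add (x := x) (κ := fun i => (q s i / p s i)⁻¹ * k' i 0) (by
        intro u hu j l
        obtain ⟨i, h1, h2, h3⟩ := ha s hs u hu j l
        refine ⟨i, h1, h2, fun h => h3 ?_⟩
        rw [← h, mul_inv_cancel_left₀ (div_ne_zero (hq s hs i) (hp s hs i))]) 0 0 0 0
      rwa [zero_smul, add_zero] at this
    · have := sum_smul_ne_add (hb s hs) 0 0 0 0
      rwa [zero_smul, add_zero] at this
  · intro s hs c hc
    have hc' := hc.smul (c := ![(∏ j, q s j)⁻¹, (∏ j, p s j)⁻¹]) (Fin.forall_fin_two.mpr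
      ⟨inv_ne_zero (right_ne_zero_of_mul hs), inv_ne_zero (left_ne_zero_of_mul hs)⟩)
    refine mem_centersLocusOffLines_of_relations hX hY hx.span_eq_top hy.span_eq_top
      (μ := fun i => q s i / p s i) (κ := fun i => k i 0) (κ' := fun i => k' i 0)
      (fun i => div_ne_zero (hq s hs i) (hp s hs i)) ?_ ?_ (r := fun _ : Fin 1 => p s) ?_ le_rfl
      ?_ ?_ (ha s hs) (hb s hs) ?_
    · simpa using hx.sum_eq_zero ![1, 0]
    · simpa using hy.sum_eq_zero ![1, 0]
    · exact LinearIndependent.of_subsingleton 0 fun h => hp s hs 0 (congrFun h 0)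
    · intro _
      simpa [p, add_comm] using hx.sum_eq_zero ![s 0, 1]
    · intro _
      simp only [div_mul_cancel₀ _ (hp s hs _)]
      simpa [q, add_comm] using hy.sum_eq_zero ![s 1, 1]
    · convert hc' using 1
      ext i j
      fin_cases i
      · simp only [Fin.zero_eta, hΦa s hs, Matrix.cons_val_zero]
        rw [inv_smul_smul₀ (right_ne_zero_of_mul hs)]
      · simp only [Fin.mk_one, hΦb s hs, Matrix.cons_val_one, Matrix.cons_val_zero]
        rw [inv_smul_smul₀ (left_ne_zero_of_mul hs)]
  · have hQ : ∏ j, k' j 1 ≠ 0 := Finset.prod_ne_zero_iff.mpr fun j _ => hk' j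
    rw [Fin.forall_fin_two]
    refine ⟨⟨0, Submodule.span ℂ {a}, fun s hs hs0 => ?_, ![1, 0], hD1, ?_, fun hmem => ?_⟩,
      ⟨0, Submodule.span ℂ {a, g}, fun s hs hs0 => ?_, ![0, 1], hD2, ?_, fun hmem => ?_⟩⟩
    · rw [hline s hs (hs0 1 (by simp)), hs0 0 le_rfl]
      exact Submodule.smul_mem _ _ (by simp)
    · intro l hl
      fin_cases l <;> simp at hl ⊢
    · rw [hline _ hD1 rfl, Submodule.smul_mem_iff _ hQ] at hmem
      obtain ⟨c, hc⟩ := Submodule.mem_span_singleton.mp hmem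
      have hrel : ∑ i, ((k' i 1)⁻¹ * ((k i 1 + k i 0 - c * k i 1) * k' i 0)) • x i = 0 := by
        rw [← sub_eq_zero.mpr hc.symm]
        simp only [a, g, Finset.smul_sum, smul_smul, ← Finset.sum_add_distrib, ← add_smul,
          ← Finset.sum_sub_distrib, ← sub_smul]
        refine Finset.sum_congr rfl fun i _ => ?_
        congr 1
        simp
        ring
      obtain ⟨e, he⟩ := (hx.relation_iff _).mp hrel
      have := h4.eq_zero le_rfl ![1, 1 - c, -e 0, -e 1] 0 0 (by
        intro i _ _
        have h := he i
        rw [Fin.sum_univ_two, inv_mul_eq_iff_eq_mul₀ (hk' i)] at h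
        simp only [sixProducts, Fin.sum_univ_four, Matrix.cons_val]
        linear_combination h)
      simpa using congrFun this 0
    · rw [hline s hs (hs0 1 le_rfl)]
      exact Submodule.smul_mem _ _ (Submodule.add_mem _ (Submodule.subset_span (by simp))
        (Submodule.smul_mem _ _ (Submodule.subset_span (by simp))))
    · intro l hl
      fin_cases l <;> simp at hl
    · rw [hΦa _ hD2, Submodule.smul_mem_iff _ (right_ne_zero_of_mul hD2)] at hmem
      obtain ⟨c, d, hcd⟩ := Submodule.mem_span_pair.mp hmem
      have hrel : ∑ i, (k i 1 * k' i 0 / (k' i 1 + k' i 0) -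
          (k' i 1)⁻¹ * ((c * k i 1 + d * k i 0) * k' i 0)) • x i = 0 := by
        rw [← sub_eq_zero.mpr hcd.symm]
        simp only [a, g, p, q, Finset.smul_sum, smul_smul, ← Finset.sum_add_distrib, ← add_smul,
          ← Finset.sum_sub_distrib, ← sub_smul]
        refine Finset.sum_congr rfl fun i _ => ?_
        congr 1
        simp
        ring
      obtain ⟨e, he⟩ := (hx.relation_iff _).mp hrel
      have : ![-d, -c, -d - e 0, 1 - c - e 1, -e 0, -e 1] = 0 := by
        refine Matrix.eq_zero_of_mulVec_eq_zero h6 ?_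
        ext i
        have h := he i
        rw [Fin.sum_univ_two] at h
        have h1 := hk' i
        have h2 := hk1' i
        field_simp at h
        simp only [sixTripleProducts, Matrix.mulVec, dotProduct, Fin.sum_univ_six, Matrix.of_apply,
          Matrix.cons_val, Pi.zero_apply]
        linear_combination h
      have h1 := congrFun this 1
      have h3 := congrFun this 3
      have h5 := congrFun this 5
      simp only [Matrix.cons_val, Pi.zero_apply, neg_eq_zero] at h1 h3 h5
      simp [h1, h5] at h3

end SixPoints

/-! ### Seven points: singular matrices give centers -/

section SevenPoints

/-- The columns of `G`, as relations of `x`. -/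
def pencilLeft (k : Fin 7 → Fin 3 → ℂ) (G : Matrix (Fin 3) (Fin 3) ℂ) (s : Fin 3) (i : Fin 7) : ℂ :=
  ∑ r, G r s * k i r

/-- The leading `2 × 2` minor of `G`. -/
def leadingMinor (G : Matrix (Fin 3) (Fin 3) ℂ) : ℂ := G 0 0 * G 1 1 - G 0 1 * G 1 0

/-- The relations of `y` that are paired with the first two columns of `G` when `G` is written as a
sum of two matrices of rank one, multiplied by the leading minor (by Cramer's rule). -/
def pencilRight (k' : Fin 7 → Fin 3 → ℂ) (G : Matrix (Fin 3) (Fin 3) ℂ) : Fin 2 → Fin 7 → ℂ :=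
  ![fun i => leadingMinor G * k' i 0 + (G 0 2 * G 1 1 - G 0 1 * G 1 2) * k' i 2,
    fun i => leadingMinor G * k' i 1 + (G 0 0 * G 1 2 - G 1 0 * G 0 2) * k' i 2]

/-- The entries at the index `i` of four vectors that span the sum of the spaces of relations of `x`
and of `y`, rescaled by `pencilRight k' G 1` and `pencilLeft k G 0`. -/
def sevenRow (k k' : Fin 7 → Fin 3 → ℂ) (G : Matrix (Fin 3) (Fin 3) ℂ) (i : Fin 7) : Fin 4 → ℂ :=
  ![pencilLeft k G 0 i * pencilRight k' G 0 i, pencilLeft k G 0 i * pencilRight k' G 1 i,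
    pencilRight k' G 1 i * k i 2, pencilLeft k G 0 i * k' i 2]

/-- The open conditions on a singular matrix `G` under which it gives a pair of centers. -/
structure IsNondegenerate (k k' : Fin 7 → Fin 3 → ℂ) (G : Matrix (Fin 3) (Fin 3) ℂ) : Prop where
  minor : leadingMinor G ≠ 0
  left : ∀ i, pencilLeft k G 0 i ≠ 0
  right : ∀ i, pencilRight k' G 1 i ≠ 0
  row : FourIndependent (sevenRow k k' G)

/-- A singular `3 × 3` matrix whose bilinear form vanishes on all pairs of rows of the Gale duals (a
fundamental matrix for the Gale dual configurations in the plane) gives a pair of centers. -/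
theorem nonempty_centersLocusOffLines_of_seven {x y : Fin 7 → Fin 4 → ℂ}
    {k k' : Fin 7 → Fin 3 → ℂ} {X Y : Fin 7 → P3} (hX : IsCoords x X) (hY : IsCoords y Y)
    (hx : IsGale x k) (hy : IsGale y k') {G : Matrix (Fin 3) (Fin 3) ℂ}
    (hG : ∀ i, ∑ r, ∑ s, G r s * (k i r * k' i s) = 0) (hdet : G.det = 0)
    (hnd : IsNondegenerate k k' G) : (centersLocusOffLines X Y).Nonempty := by
  obtain ⟨hδ, hl, hr, hrow⟩ := hnd
  -- Up to a factor, the singular matrix `G` is a sum of two matrices of rank one; their values on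
  -- each pair of rows are opposite.
  have hpair : ∀ i, pencilLeft k G 0 i * pencilRight k' G 0 i =
      -(pencilLeft k G 1 i * pencilRight k' G 1 i) := by
    intro i
    have h := hG i
    simp only [Fin.sum_univ_three] at h
    rw [Matrix.det_fin_three] at hdet
    simp only [pencilLeft, pencilRight, leadingMinor, Fin.sum_univ_three, Matrix.cons_val]
    linear_combination (G 0 0 * G 1 1 - G 0 1 * G 1 0) * h - k i 2 * k' i 2 * hdet
  -- Hence one rescaling `μ` maps `w₁`, `w₂` to `v₂`, `-v₁`.
  set w₁ := pencilLeft k G 0 with hw₁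
  set w₂ := pencilLeft k G 1 with hw₂
  set v₁ := pencilRight k' G 0 with hv₁
  set v₂ := pencilRight k' G 1 with hv₂
  let μ : Fin 7 → ℂ := fun i => v₂ i / w₁ i
  have hμ : ∀ i, μ i ≠ 0 := fun i => div_ne_zero (hr i) (hl i)
  have hμ₁ : ∀ i, μ i * w₁ i = v₂ i := fun i => div_mul_cancel₀ _ (hl i)
  have hμ₂ : ∀ i, μ i * w₂ i = -v₁ i := fun i => by
    refine mul_left_cancel₀ (hl i) ?_
    rw [← mul_assoc, mul_comm (w₁ i), hμ₁, mul_neg, hpair i]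
    ring
  have hsum : ∀ (i : Fin 7) (c : Fin 4 → ℂ), ∑ r, sevenRow k k' G i r * c r =
      w₁ i * v₁ i * c 0 + w₁ i * v₂ i * c 1 + v₂ i * k i 2 * c 2 + w₁ i * k' i 2 * c 3 := by
    intro i c
    simp only [sevenRow, Fin.sum_univ_four, Matrix.cons_val]
    rfl
  have ha : ∀ u : Fin 7 → ℂ, ∑ i, u i • x i = 0 →
      ∀ j l, ∃ i, i ≠ j ∧ i ≠ l ∧ k' i 2 ≠ μ i * u i := by
    intro u hu j l
    obtain ⟨c, hc⟩ := (hx.relation_iff u).mp hu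
    by_contra! hcon
    have := hrow.eq_zero (by norm_num) ![c 1 * G 0 0 - c 0 * G 1 0, -(c 0 * G 1 1 - c 1 * G 0 1),
      -(leadingMinor G * c 2 - (c 0 * G 1 1 - c 1 * G 0 1) * G 2 0 -
        (c 1 * G 0 0 - c 0 * G 1 0) * G 2 1), leadingMinor G] j l (by
      intro i hj hl'
      have h := hcon i hj hl'
      have h1 : w₁ i * k' i 2 = v₂ i * u i := by
        rw [h, ← hμ₁]; ring
      rw [hc] at h1
      have h2 : ∀ s, pencilLeft k G s i = G 0 s * k i 0 + G 1 s * k i 1 + G 2 s * k i 2 :=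
        fun s => Fin.sum_univ_three _
      have e₁ := h2 0
      have e₂ := h2 1
      rw [← hw₁] at e₁
      rw [← hw₂] at e₂
      rw [Fin.sum_univ_three] at h1
      rw [hsum, hpair i]
      simp only [Matrix.cons_val]
      simp only [leadingMinor]
      linear_combination (G 0 0 * G 1 1 - G 0 1 * G 1 0) * h1 -
        v₂ i * (c 1 * G 0 0 - c 0 * G 1 0) * e₂ - v₂ i * (c 0 * G 1 1 - c 1 * G 0 1) * e₁)
    exact hδ (congrFun this 3)
  have hb : ∀ u : Fin 7 → ℂ, ∑ i, u i • y i = 0 →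
      ∀ j l, ∃ i, i ≠ j ∧ i ≠ l ∧ μ i * k i 2 ≠ u i := by
    intro u hu j l
    obtain ⟨c, hc⟩ := (hy.relation_iff u).mp hu
    by_contra! hcon
    have := hrow.eq_zero (by norm_num) ![-c 0, -c 1, leadingMinor G, -(leadingMinor G * c 2 -
      c 0 * (G 0 2 * G 1 1 - G 0 1 * G 1 2) - c 1 * (G 0 0 * G 1 2 - G 1 0 * G 0 2))] j l (by
      intro i hj hl'
      have h := hcon i hj hl'
      have h1 : v₂ i * k i 2 = w₁ i * u i := by
        rw [← h, ← hμ₁]; ring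
      rw [hc, Fin.sum_univ_three] at h1
      have e₁ : v₁ i = leadingMinor G * k' i 0 + (G 0 2 * G 1 1 - G 0 1 * G 1 2) * k' i 2 := rfl
      have e₂ : v₂ i = leadingMinor G * k' i 1 + (G 0 0 * G 1 2 - G 1 0 * G 0 2) * k' i 2 := rfl
      rw [hsum]
      simp only [Matrix.cons_val]
      linear_combination leadingMinor G * h1 - c 0 * w₁ i * e₁ - c 1 * w₁ i * e₂)
    exact hδ (congrFun this 2)
  have hne : ∀ j : Fin 2, ![∑ i, ((μ i)⁻¹ * k' i 2) • x i, ∑ i, (μ i * k i 2) • y i] j ≠ 0 := by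
    rw [Fin.forall_fin_two]
    constructor
    · have := sum_smul_ne_add (x := x) (κ := fun i => (μ i)⁻¹ * k' i 2) (by
        intro u hu j l
        obtain ⟨i, h1, h2, h3⟩ := ha u hu j l
        refine ⟨i, h1, h2, fun h => h3 ?_⟩
        rw [← h, mul_inv_cancel_left₀ (hμ i)]) 0 0 0 0
      rwa [zero_smul, add_zero] at this
    · have := sum_smul_ne_add hb 0 0 0 0
      rwa [zero_smul, add_zero] at this
  refine ⟨_, mem_centersLocusOffLines_of_relations hX hY hx.span_eq_top hy.span_eq_top hμ
    (κ := fun i => k i 2) (κ' := fun i => k' i 2) ?_ ?_ (r := ![w₁, w₂]) ?_ le_rfl ?_ ?_ ha hb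
    (isCoords_mk hne)⟩
  · simpa [Fin.sum_univ_three] using hx.sum_eq_zero ![0, 0, 1]
  · simpa [Fin.sum_univ_three] using hy.sum_eq_zero ![0, 0, 1]
  · rw [LinearIndependent.pair_iff]
    intro α β h
    have := hrow.eq_zero (by norm_num) ![-β, α, 0, 0] 0 0 (by
      intro i _ _
      have h1 := congrFun h i
      simp only [Pi.add_apply, Pi.smul_apply, smul_eq_mul, Pi.zero_apply] at h1
      rw [hsum, hpair i]
      simp only [Matrix.cons_val]
      linear_combination v₂ i * h1)
    exact ⟨congrFun this 1, neg_eq_zero.mp (congrFun this 0)⟩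
  · rw [Fin.forall_fin_two]
    exact ⟨hx.sum_eq_zero fun r => G r 0, hx.sum_eq_zero fun r => G r 1⟩
  · rw [Fin.forall_fin_two]
    constructor
    · simp only [Matrix.cons_val_zero, hμ₁]
      convert hy.sum_eq_zero ![0, leadingMinor G, G 0 0 * G 1 2 - G 1 0 * G 0 2] using 3
      simp [Fin.sum_univ_three, hv₂, pencilRight]
    · simp only [Matrix.cons_val_one, Matrix.cons_val_zero, hμ₂]
      convert hy.sum_eq_zero ![-leadingMinor G, 0, -(G 0 2 * G 1 1 - G 0 1 * G 1 2)] using 3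
      simp only [Fin.sum_univ_three, hv₁, pencilRight, Matrix.cons_val]
      ring

end SevenPoints

/-! ### Seven points: the pencil of matrices -/

/-- The coefficient matrix of the linear system that seven pairs of rows of Gale duals impose on
the entries of a `3 × 3` matrix other than the entries `(0, 0)` and `(0, 1)`. -/
def sevenSystem (k k' : Fin 7 → Fin 3 → ℂ) : Matrix (Fin 7) (Fin 7) ℂ :=
  Matrix.of fun i => ![k i 1 * k' i 0, k i 1 * k' i 1, k i 0 * k' i 2, k i 2 * k' i 0,
    k i 1 * k' i 2, k i 2 * k' i 1, k i 2 * k' i 2]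

/-- The `3 × 3` matrix with entries `u`, `v` at `(0, 0)` and `(0, 1)`, and the entries of `g`
elsewhere, in the order of the columns of `sevenSystem`. -/
def fillMatrix (u v : ℂ) (g : Fin 7 → ℂ) : Matrix (Fin 3) (Fin 3) ℂ :=
  !![u, v, g 2; g 0, g 1, g 4; g 3, g 5, g 6]

/-- The member with parameter `t` of the pencil of matrices whose bilinear forms vanish on the seven
pairs of rows of the Gale duals, by Cramer's rule. -/
def sevenPencil (k k' : Fin 7 → Fin 3 → ℂ) (t : ℂ) : Matrix (Fin 3) (Fin 3) ℂ :=
  fillMatrix (-t * (sevenSystem k k').det) (sevenSystem k k').det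
    ((sevenSystem k k').adjugate.mulVec
      fun i => t * (k i 0 * k' i 0) - k i 0 * k' i 1)

theorem sum_sevenPencil (k k' : Fin 7 → Fin 3 → ℂ) (t : ℂ) (i : Fin 7) :
    ∑ r, ∑ s, sevenPencil k k' t r s * (k i r * k' i s) = 0 := by
  have h := congrFun (Matrix.mulVec_mulVec (fun i => t * (k i 0 * k' i 0) - k i 0 * k' i 1)
    (sevenSystem k k') (sevenSystem k k').adjugate) i
  rw [Matrix.mul_adjugate, Matrix.smul_mulVec, Matrix.one_mulVec] at h
  simp only [sevenPencil]
  generalize (sevenSystem k k').adjugate.mulVec _ = g at h ⊢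
  simp only [Matrix.mulVec, dotProduct, sevenSystem, Fin.sum_univ_seven, Matrix.of_apply,
    Matrix.cons_val, Pi.smul_apply, smul_eq_mul] at h
  simp only [fillMatrix, Fin.sum_univ_three, Matrix.of_apply, Matrix.cons_val, sevenSystem]
  linear_combination h

/-- The coefficients of the cubic `det (A + t B)` in `t`. -/
def pencilCubic (A B : Matrix (Fin 3) (Fin 3) ℂ) : Fin 4 → ℂ :=
  ![A.det, ∑ r, (A.updateRow r (B r)).det, ∑ r, (B.updateRow r (A r)).det, B.det]

theorem sum_pencilCubic (A B : Matrix (Fin 3) (Fin 3) ℂ) (t : ℂ) :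
    ∑ i, pencilCubic A B i * t ^ (i : ℕ) = (A + t • B).det := by
  simp [pencilCubic, Fin.sum_univ_four, Fin.sum_univ_three, Matrix.det_fin_three,
    Matrix.updateRow_apply]
  ring

theorem sevenPencil_eq_add (k k' : Fin 7 → Fin 3 → ℂ) (t : ℂ) :
    sevenPencil k k' t = sevenPencil k k' 0 + t • (sevenPencil k k' 1 - sevenPencil k k' 0) := by
  have h : ∀ s : ℂ, (fun i => s * (k i 0 * k' i 0) - k i 0 * k' i 1) =
      s • (fun i => k i 0 * k' i 0) - fun i => k i 0 * k' i 1 := fun s => rfl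
  simp only [sevenPencil, h, Matrix.mulVec_sub, Matrix.mulVec_smul]
  ext i j
  fin_cases i <;> fin_cases j <;> simp [fillMatrix] <;> ring

/-- The first of two special Gale duals for which the pencil can be computed. -/
def sevenLeft (i : Fin 7) : Fin 3 → ℂ := ![1, (i : ℂ) + 1, ((i : ℂ) + 1) ^ 3]

/-- The second of two special Gale duals for which the pencil can be computed. -/
def sevenRight (i : Fin 7) : Fin 3 → ℂ := ![(i : ℂ) + 1, ((i : ℂ) + 1) ^ 2, 1 - ((i : ℂ) + 1) ^ 4]

theorem det_sevenSystem_ne_zero : (sevenSystem sevenLeft sevenRight).det ≠ 0 := by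
  intro hdet
  obtain ⟨g, hg, h0⟩ := Matrix.exists_mulVec_eq_zero_iff.mpr hdet
  refine hg ?_
  have h : ∀ i, _ := fun i => congrFun h0 i
  simp only [Matrix.mulVec, dotProduct, sevenSystem, Fin.sum_univ_seven, Matrix.of_apply,
    Matrix.cons_val, Pi.zero_apply, sevenLeft, sevenRight] at h
  have h0 := h 0
  have h1 := h 1
  have h2 := h 2
  have h3 := h 3
  have h4 := h 4
  have h5 := h 5
  have h6 := h 6
  clear h
  norm_num at h0 h1 h2 h3 h4 h5 h6
  -- The rows of the inverse of the system.
  ext m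
  fin_cases m <;> simp only [Fin.zero_eta, Fin.mk_one, Fin.reduceFinMk, Pi.zero_apply]
  · linear_combination (103/16) * h0 + (-173/6) * h1 + (881/16) * h2 + (-173/3) * h3 +
      (1675/48) * h4 + (-23/2) * h5 + (77/48) * h6
  · linear_combination (-3985/2016) * h0 + (3299/336) * h1 + (-13681/672) * h2 +
      (11399/504) * h3 + (-9565/672) * h4 + (1619/336) * h5 + (-1381/2016) * h6
  · linear_combination (27/4) * h0 + (-39/2) * h1 + (125/4) * h2 + (-30) * h3 + (69/4) * h4 +
      (-11/2) * h5 + (3/4) * h6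
  · linear_combination (113/16) * h0 + (-127/6) * h1 + (559/16) * h2 + (-103/3) * h3 +
      (965/48) * h4 + (-13/2) * h5 + (43/48) * h6
  · linear_combination (-5881/560) * h0 + (11217/280) * h1 + (-23305/336) * h2 + (1933/28) * h3 +
      (-4539/112) * h4 + (10999/840) * h5 + (-1009/560) * h6
  · linear_combination (-21215/2016) * h0 + (13501/336) * h1 + (-46799/672) * h2 +
      (34969/504) * h3 + (-27395/672) * h4 + (4429/336) * h5 + (-3659/2016) * h6
  · linear_combination (-1/20160) * h0 + (1/3360) * h1 + (-1/1344) * h2 + (1/1008) * h3 +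
      (-1/1344) * h4 + (1/3360) * h5 + (-1/20160) * h6

/-- At the special Gale duals the cubic `det` is a multiple of `t ^ 3`, and `t = 0` gives a
nondegenerate matrix. -/
theorem sevenPencil_special (t : ℂ) : sevenPencil sevenLeft sevenRight t =
    (sevenSystem sevenLeft sevenRight).det • !![-t, 1, 0; -1, 0, t; 0, t, 0] := by
  have h : (fun i => t * (sevenLeft i 0 * sevenRight i 0) - sevenLeft i 0 * sevenRight i 1) =
      (sevenSystem sevenLeft sevenRight).mulVec ![-1, 0, 0, 0, t, t, 0] := by
    ext i
    simp only [Matrix.mulVec, dotProduct, sevenSystem, Fin.sum_univ_seven, Matrix.of_apply,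
      Matrix.cons_val, sevenLeft, sevenRight]
    ring
  rw [sevenPencil, h, Matrix.mulVec_mulVec, Matrix.adjugate_mul, Matrix.smul_mulVec,
    Matrix.one_mulVec]
  ext i j
  fin_cases i <;> fin_cases j <;> simp [fillMatrix]
  ring

theorem natCast_add_one_injective {n : ℕ} : Function.Injective fun i : Fin n => (i : ℂ) + 1 :=
  fun i j h => by
    simp only [add_left_inj, Nat.cast_inj] at h
    exact Fin.ext h

theorem isNondegenerate_sevenPencil_special :
    IsNondegenerate sevenLeft sevenRight (sevenPencil sevenLeft sevenRight 0) := by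
  have hΔ := det_sevenSystem_ne_zero
  rw [sevenPencil_special]
  set Δ := (sevenSystem sevenLeft sevenRight).det
  have hz : ∀ i : Fin 7, (i : ℂ) + 1 ≠ 0 := fun i => Nat.cast_add_one_ne_zero _
  have hminor : leadingMinor (Δ • !![-0, 1, 0; -1, 0, 0; 0, 0, 0]) = Δ ^ 2 := by
    simp [leadingMinor, sq]
  have hleft : ∀ i, pencilLeft sevenLeft (Δ • !![-0, 1, 0; -1, 0, 0; 0, 0, 0]) 0 i =
      -(Δ * ((i : ℂ) + 1)) := fun i => by
    simp [pencilLeft, sevenLeft, Fin.sum_univ_three]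
  have hright₀ : ∀ i, pencilRight sevenRight (Δ • !![-0, 1, 0; -1, 0, 0; 0, 0, 0]) 0 i =
      Δ ^ 2 * ((i : ℂ) + 1) := fun i => by
    simp [pencilRight, leadingMinor, sevenRight, sq]
  have hright₁ : ∀ i, pencilRight sevenRight (Δ • !![-0, 1, 0; -1, 0, 0; 0, 0, 0]) 1 i =
      Δ ^ 2 * ((i : ℂ) + 1) ^ 2 := fun i => by
    simp [pencilRight, leadingMinor, sevenRight, sq]
  refine ⟨hminor ▸ pow_ne_zero _ hΔ, fun i => ?_, fun i => ?_, fun e => ?_⟩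
  · rw [hleft]
    exact neg_ne_zero.mpr (mul_ne_zero hΔ (hz i))
  · rw [hright₁]
    exact mul_ne_zero (pow_ne_zero _ hΔ) (pow_ne_zero _ (hz i))
  · simp only [Matrix.det_succ_row_zero, sevenRow, hleft, hright₀, hright₁]
    have hd : ∀ r s, r ≠ s → ((e r : ℕ) : ℂ) + 1 - (((e s : ℕ) : ℂ) + 1) ≠ 0 := fun r s hrs =>
      sub_ne_zero.mpr fun h => hrs (e.injective (natCast_add_one_injective h))
    have h01 := hd 0 1 (by decide)
    have h02 := hd 0 2 (by decide)
    have h03 := hd 0 3 (by decide)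
    have h12 := hd 1 2 (by decide)
    have h13 := hd 1 3 (by decide)
    have h23 := hd 2 3 (by decide)
    have hs : ((e 0 : ℕ) : ℂ) + 1 + (((e 1 : ℕ) : ℂ) + 1) + (((e 2 : ℕ) : ℂ) + 1) +
        (((e 3 : ℕ) : ℂ) + 1) ≠ 0 := by
      norm_cast
    have hz0 := hz (e 0)
    have hz1 := hz (e 1)
    have hz2 := hz (e 2)
    have hz3 := hz (e 3)
    simp [Fin.sum_univ_succ, sevenLeft, sevenRight, Fin.succAbove]
    generalize ((e 0 : ℕ) : ℂ) + 1 = a at *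
    generalize ((e 1 : ℕ) : ℂ) + 1 = b at *
    generalize ((e 2 : ℕ) : ℂ) + 1 = c at *
    generalize ((e 3 : ℕ) : ℂ) + 1 = d at *
    -- A generalized Vandermonde determinant, with exponents `0, 1, 2, 4`.
    have : Δ ^ 9 * (a * b * c * d) * ((a - b) * (a - c) * (a - d) * (b - c) * (b - d) * (c - d)) *
      (a + b + c + d) ≠ 0 := by positivity
    intro h
    apply this
    linear_combination h

theorem isPolyFun_sevenPencil {σ : Type} {k k' : (σ → ℂ) → Fin 7 → Fin 3 → ℂ} {t : (σ → ℂ) → ℂ}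
    (hk : ∀ i j, IsPolyFun fun v => k v i j) (hk' : ∀ i j, IsPolyFun fun v => k' v i j)
    (ht : IsPolyFun t) (r s : Fin 3) :
    IsPolyFun fun v => sevenPencil (k v) (k' v) (t v) r s := by
  have hC : ∀ i m, IsPolyFun fun v => sevenSystem (k v) (k' v) i m := by
    intro i m
    fin_cases m <;> exact (hk _ _).mul (hk' _ _)
  have hd : IsPolyFun fun v => (sevenSystem (k v) (k' v)).det := IsPolyFun.det hC
  have hg : ∀ i, IsPolyFun fun v => (sevenSystem (k v) (k' v)).adjugate.mulVec
      (fun i => t v * (k v i 0 * k' v i 0) - k v i 0 * k' v i 1) i := fun i => by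
    simp only [Matrix.mulVec, dotProduct]
    exact IsPolyFun.sum fun j => (IsPolyFun.adjugate hC i j).mul
      ((ht.mul ((hk j 0).mul (hk' j 0))).sub ((hk j 0).mul (hk' j 1)))
  fin_cases r <;> fin_cases s
  · exact ht.neg.mul hd
  · exact hd
  all_goals exact hg _

theorem eventually_isNondegenerate {σ : Type} {k k' : (σ → ℂ) → Fin 7 → Fin 3 → ℂ}
    {G : (σ → ℂ) → Matrix (Fin 3) (Fin 3) ℂ}
    (hk : ∀ i j, IsPolyFun fun v => k v i j) (hk' : ∀ i j, IsPolyFun fun v => k' v i j)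
    (hG : ∀ r s, IsPolyFun fun v => G v r s) {v₀ : σ → ℂ}
    (h : IsNondegenerate (k v₀) (k' v₀) (G v₀)) :
    ∀ᶠ v in zariskiNhds v₀, IsNondegenerate (k v) (k' v) (G v) := by
  have hm : IsPolyFun fun v => leadingMinor (G v) :=
    ((hG 0 0).mul (hG 1 1)).sub ((hG 0 1).mul (hG 1 0))
  have hl : ∀ i, IsPolyFun fun v => pencilLeft (k v) (G v) 0 i := fun i =>
    IsPolyFun.sum fun r => (hG r 0).mul (hk i r)
  have hr : ∀ j i, IsPolyFun fun v => pencilRight (k' v) (G v) j i := by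
    intro j i
    fin_cases j
    · exact (hm.mul (hk' i 0)).add
        ((((hG 0 2).mul (hG 1 1)).sub ((hG 0 1).mul (hG 1 2))).mul (hk' i 2))
    · exact (hm.mul (hk' i 1)).add
        ((((hG 0 0).mul (hG 1 2)).sub ((hG 1 0).mul (hG 0 2))).mul (hk' i 2))
  have hrow : ∀ i r, IsPolyFun fun v => sevenRow (k v) (k' v) (G v) i r := by
    intro i r
    fin_cases r
    · exact (hl i).mul (hr 0 i)
    · exact (hl i).mul (hr 1 i)
    · exact (hr 1 i).mul (hk i 2)
    · exact (hl i).mul (hk' i 2)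
  filter_upwards [hm.eventually_ne h.minor,
    Filter.eventually_all.mpr fun i => (hl i).eventually_ne (h.left i),
    Filter.eventually_all.mpr fun i => (hr 1 i).eventually_ne (h.right i),
    eventually_fourIndependent hrow h.row] with v h1 h2 h3 h4
  exact ⟨h1, h2, h3, h4⟩

/-- Gale duals near the special ones have a pencil with a nondegenerate singular member: the cubic
`det` on the pencil has, at the special Gale duals, the triple root `0`, and the member at `0` is
nondegenerate there. -/
theorem eventually_exists_isNondegenerate :
    ∀ᶠ w in zariskiNhds (Sum.elim (fun p => sevenLeft p.1 p.2) fun p => sevenRight p.1 p.2 :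
        (Fin 7 × Fin 3) ⊕ (Fin 7 × Fin 3) → ℂ),
      ∃ t, (sevenPencil (fun i j => w (.inl (i, j))) (fun i j => w (.inr (i, j))) t).det = 0 ∧
        IsNondegenerate (fun i j => w (.inl (i, j))) (fun i j => w (.inr (i, j)))
          (sevenPencil (fun i j => w (.inl (i, j))) (fun i j => w (.inr (i, j))) t) := by
  let P : ((Fin 7 × Fin 3) ⊕ (Fin 7 × Fin 3) → ℂ) → ℂ → Matrix (Fin 3) (Fin 3) ℂ :=
    fun w => sevenPencil (fun i j => w (.inl (i, j))) (fun i j => w (.inr (i, j)))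
  have hP : ∀ t r s, IsPolyFun fun w => P w t r s := fun t =>
    isPolyFun_sevenPencil (fun i j => .coord _) (fun i j => .coord _) (.const t)
  have hQ : ∀ r s, IsPolyFun fun w => (P w 1 - P w 0) r s := fun r s => (hP 1 r s).sub (hP 0 r s)
  have hΔ := det_sevenSystem_ne_zero
  have hupd : ∀ {A B : ((Fin 7 × Fin 3) ⊕ (Fin 7 × Fin 3) → ℂ) → Matrix (Fin 3) (Fin 3) ℂ},
      (∀ r s, IsPolyFun fun w => A w r s) → (∀ r s, IsPolyFun fun w => B w r s) →
      IsPolyFun fun w => ∑ r, ((A w).updateRow r (B w r)).det := by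
    intro A B hA hB
    refine IsPolyFun.sum fun r => IsPolyFun.det fun i j => ?_
    simp only [Matrix.updateRow_apply]
    split_ifs
    exacts [hB _ _, hA _ _]
  have h := eventually_exists_root (d := 3) (by norm_num)
    (c := fun i w => pencilCubic (P w 0) (P w 1 - P w 0) i) (by
      intro i
      fin_cases i
      exacts [IsPolyFun.det (hP 0), hupd (hP 0) hQ, hupd hQ (hP 0), IsPolyFun.det hQ])
    (v₀ := Sum.elim (fun p => sevenLeft p.1 p.2) fun p => sevenRight p.1 p.2) (by
      intro i
      have h0 : ∀ t, P (Sum.elim (fun p => sevenLeft p.1 p.2) fun p => sevenRight p.1 p.2) t = _ :=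
        sevenPencil_special
      simp only [h0]
      fin_cases i <;> simp [pencilCubic, Matrix.det_fin_three, Fin.sum_univ_three,
        Matrix.updateRow_apply, hΔ])
    (p := fun o => IsNondegenerate (fun i j => o (some (.inl (i, j))))
      (fun i j => o (some (.inr (i, j))))
      (sevenPencil (fun i j => o (some (.inl (i, j)))) (fun i j => o (some (.inr (i, j))))
        (o none))) (eventually_isNondegenerate (fun i j => .coord _) (fun i j => .coord _)
      (isPolyFun_sevenPencil (fun i j => .coord _) (fun i j => .coord _) (.coord _))
      isNondegenerate_sevenPencil_special)
  filter_upwards [h] with w hw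
  obtain ⟨t, ht, hnd⟩ := hw
  refine ⟨t, ?_, hnd⟩
  rw [sevenPencil_eq_add, ← sum_pencilCubic]
  exact ht

/-! ### Generic points -/

theorem holdsForGenericPair_le_topologicalKrullDim_seven : HoldsForGenericPair 7 fun X Y =>
    ((0 : ℕ) : WithBot ℕ∞) ≤ topologicalKrullDim (closure (centersLocusOffLines X Y)) := by
  refine holdsForGenericPair_of_isGale (m := 3) sevenLeft sevenRight ?_ ?_ ?_
  · simp [Matrix.det_fin_three, sevenLeft, Fin.natAdd]
    norm_num
  · simp [Matrix.det_fin_three, sevenRight, Fin.natAdd]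
    norm_num
  · filter_upwards [eventually_exists_isNondegenerate] with w hw x y X Y hX hY hx hy
    obtain ⟨t, ht, hnd⟩ := hw
    have hne := nonempty_centersLocusOffLines_of_seven hX hY hx hy (sum_sevenPencil _ _ t) ht hnd
    obtain ⟨c, hc⟩ := hne.closure
    have : Nonempty (TopologicalSpace.IrreducibleCloseds (closure (centersLocusOffLines X Y))) :=
      ⟨⟨irreducibleComponent ⟨c, hc⟩, isIrreducible_irreducibleComponent,
        isClosed_irreducibleComponent⟩⟩
    exact Order.krullDim_nonneg

theorem holdsForGenericPair_le_topologicalKrullDim_six : HoldsForGenericPair 6 fun X Y =>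
    ((2 : ℕ) : WithBot ℕ∞) ≤ topologicalKrullDim (closure (centersLocusOffLines X Y)) := by
  let k₀ : Fin 6 → Fin 2 → ℂ := fun i => ![1, (i : ℂ) + 1]
  let k₀' : Fin 6 → Fin 2 → ℂ := fun i => ![1, ((i : ℂ) + 1) ^ 2]
  -- For these Gale duals the products of relations are consecutive powers of `i + 1`.
  have hvand : ∀ {n : ℕ} (e : Fin n ↪ Fin 6),
      (Matrix.vandermonde fun i => ((e i : ℕ) : ℂ) + 1).det ≠ 0 := fun e =>
    Matrix.det_vandermonde_ne_zero_iff.mpr (natCast_add_one_injective.comp e.injective)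
  refine holdsForGenericPair_of_isGale (m := 2) k₀ k₀' ?_ ?_ ?_
  · simp [Matrix.det_fin_two, k₀, Fin.natAdd]
  · simp [Matrix.det_fin_two, k₀', Fin.natAdd]
    norm_num
  · let K : ((Fin 6 × Fin 2) ⊕ (Fin 6 × Fin 2) → ℂ) → Fin 6 → Fin 2 → ℂ :=
      fun w i j => w (.inl (i, j))
    let K' : ((Fin 6 × Fin 2) ⊕ (Fin 6 × Fin 2) → ℂ) → Fin 6 → Fin 2 → ℂ :=
      fun w i j => w (.inr (i, j))
    let w₀ : (Fin 6 × Fin 2) ⊕ (Fin 6 × Fin 2) → ℂ :=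
      Sum.elim (fun p => k₀ p.1 p.2) fun p => k₀' p.1 p.2
    have hK : ∀ i j, IsPolyFun fun w => K w i j := fun i j => .coord _
    have hK' : ∀ i j, IsPolyFun fun w => K' w i j := fun i j => .coord _
    have h4 : ∀ᶠ w in zariskiNhds w₀, FourIndependent (sixProducts (K w) (K' w)) := by
      refine eventually_fourIndependent (fun i r => ?_) fun e => ?_
      · fin_cases r <;> exact (hK _ _).mul (hK' _ _)
      · convert hvand e using 2
        ext i r
        fin_cases r <;> simp [K, K', w₀, k₀, k₀', sixProducts, Matrix.vandermonde]
        ring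
    have h6 : ∀ᶠ w in zariskiNhds w₀, (Matrix.of (sixTripleProducts (K w) (K' w))).det ≠ 0 := by
      refine IsPolyFun.eventually_ne (IsPolyFun.det fun i r => ?_) ?_
      · fin_cases r
        exacts [(hK _ _).mul ((hK' _ _).pow 2), (hK _ _).mul ((hK' _ _).pow 2),
          (hK _ _).mul ((hK' _ _).mul (hK' _ _)), (hK _ _).mul ((hK' _ _).mul (hK' _ _)),
          (hK _ _).mul ((hK' _ _).pow 2), (hK _ _).mul ((hK' _ _).pow 2)]
      · convert hvand (.refl _) using 2
        ext i r
        fin_cases r <;> simp [K, K', w₀, k₀, k₀', sixTripleProducts, Matrix.vandermonde] <;> ring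
    have h1 : ∀ i, ∀ᶠ w in zariskiNhds w₀, K w i 1 ≠ 0 := fun i =>
      (hK i 1).eventually_ne (Nat.cast_add_one_ne_zero _)
    have h1' : ∀ i, ∀ᶠ w in zariskiNhds w₀, K' w i 1 ≠ 0 := fun i =>
      (hK' i 1).eventually_ne (pow_ne_zero _ (Nat.cast_add_one_ne_zero _))
    have h2 : ∀ i, ∀ᶠ w in zariskiNhds w₀, K w i 1 + K w i 0 ≠ 0 := fun i =>
      ((hK i 1).add (hK i 0)).eventually_ne (by
        simp only [K, w₀, k₀, Sum.elim_inl, Matrix.cons_val_one, Matrix.cons_val_zero]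
        norm_cast)
    have h2' : ∀ i, ∀ᶠ w in zariskiNhds w₀, K' w i 1 + K' w i 0 ≠ 0 := fun i =>
      ((hK' i 1).add (hK' i 0)).eventually_ne (by
        simp only [K', w₀, k₀', Sum.elim_inr, Matrix.cons_val_one, Matrix.cons_val_zero]
        norm_cast)
    filter_upwards [h4, h6, Filter.eventually_all.mpr h1, Filter.eventually_all.mpr h1',
      Filter.eventually_all.mpr h2, Filter.eventually_all.mpr h2'] with
      w h4 h6 h1 h1' h2 h2' x y X Y hX hY hx hy
    exact le_topologicalKrullDim_of_six hX hY hx hy h4 h6 h1 h1' h2 h2'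

theorem holdsForGenericPair_le_topologicalKrullDim_five : HoldsForGenericPair 5 fun X Y =>
    ((4 : ℕ) : WithBot ℕ∞) ≤ topologicalKrullDim (closure (centersLocusOffLines X Y)) := by
  refine holdsForGenericPair_of_isGale (m := 1) (fun _ _ => 1) (fun _ _ => 1) (by simp) (by simp) ?_
  have h : ∀ (i : Fin 5), ∀ᶠ w in zariskiNhds (Sum.elim (fun _ => 1) fun _ => 1 :
      (Fin 5 × Fin 1) ⊕ (Fin 5 × Fin 1) → ℂ), w (.inl (i, 0)) ≠ 0 := fun i =>
    (IsPolyFun.coord _).eventually_ne one_ne_zero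
  have h' : ∀ (i : Fin 5), ∀ᶠ w in zariskiNhds (Sum.elim (fun _ => 1) fun _ => 1 :
      (Fin 5 × Fin 1) ⊕ (Fin 5 × Fin 1) → ℂ), w (.inr (i, 0)) ≠ 0 := fun i =>
    (IsPolyFun.coord _).eventually_ne one_ne_zero
  filter_upwards [Filter.eventually_all.mpr h, Filter.eventually_all.mpr h'] with
    w h h' x y X Y hX hY hx hy
  exact le_topologicalKrullDim_of_five hX hY hx hy h h'

theorem mainTheorem5 (n : ℕ) :
    (n ≤ 4 → HoldsForGenericPair n fun X Y =>
      centersVariety X Y = Set.univ ∧ centersVarietyOffLines X Y = Set.univ) ∧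
    (5 ≤ n → n ≤ 7 → HoldsForGenericPair n fun X Y =>
      ((14 - 2 * n : ℕ) : WithBot ℕ∞) ≤ topologicalKrullDim (centersVariety X Y) ∧
      ((14 - 2 * n : ℕ) : WithBot ℕ∞) ≤ topologicalKrullDim (centersVarietyOffLines X Y)) := by
  refine ⟨holdsForGenericPair_centersVariety_eq_univ, fun h5 h7 => ?_⟩
  suffices HoldsForGenericPair n fun X Y => ((14 - 2 * n : ℕ) : WithBot ℕ∞) ≤
      topologicalKrullDim (closure (centersLocusOffLines X Y)) by
    obtain ⟨U, hU, hne, h⟩ := this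
    exact ⟨U, hU, hne, fun X Y hXY => ⟨(h X Y hXY).trans
      (topologicalKrullDim_closure_mono (centersLocusOffLines_subset X Y)), h X Y hXY⟩⟩
  interval_cases n
  exacts [holdsForGenericPair_le_topologicalKrullDim_five,
    holdsForGenericPair_le_topologicalKrullDim_six,
    holdsForGenericPair_le_topologicalKrullDim_seven]
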